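/- Let $\sigma,\alpha:\mathbb{R}_+\to\mathbb{R}$ be functions in $L^1(\mathbb{R}_+)\cap L^\infty(\mathbb{R}_+)$, where $\mathbb{R}_+=(0,\infty)$. On the form domain $H^1(\mathbb{R}_+^2)\subset L^2(\mathbb{R}_+^2)$ (complex-valued functions) consider the quadratic form $$q[\varphi]=\int_{\mathbb{R}_+^2}|\nabla\varphi|^2\,dx-\int_0^\infty\sigma(y)\bigl(|\varphi(y,0)|^2+|\varphi(0,y)|^2\bigr)\,dy+\int_0^\infty\alpha(y)\,|\varphi(y,y)|^2\,dy ,$$ where $\varphi(\cdot,0)$, $\varphi(0,\cdot)$ and $\varphi(y,y)$ are the traces of $\varphi$ on the two boundary half-lines and on the diagonal. Let $-\Delta^{d=\infty}_{\sigma,\alpha}$ be the self-adjoint operator in $L^2(\mathbb{R}_+^2)$ associated with $q$: $\varphi$ lies in its domain and is mapped to $f\in L^2(\mathbb{R}_+^2)$ if and only if $\varphi\in H^1(\mathbb{R}_+^2)$ and $q(\psi,\varphi)=\langle\psi,f\rangle$ for all $\psi\in H^1(\mathbb{R}_+^2)$, where $q(\cdot,\cdot)$ is the sesquilinear form of $q$.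 Let the discrete spectrum be the set of eigenvalues of finite multiplicity that are isolated points of the spectrum, and let the essential spectrum $\sigma_{ess}$ be the rest of the spectrum. Assume that $\inf\sigma_{ess}(-\Delta^{d=\infty}_{\sigma,\alpha})=0$ and that $$\int_{\mathbb{R}_+}\bigl[2\sigma(y)-\alpha(y)\bigr]\,dy>0 .$$ Then $-\Delta^{d=\infty}_{\sigma,\alpha}$ has negative eigenvalues: there is an eigenvalue $E<0$, and it belongs to the discrete spectrum. -/

import Mathlib

open MeasureTheory Set Filter Topology
open scoped ENNReal ContDiff ComplexConjugate

namespace TwoParticle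

noncomputable section

/-! ### Spectral notions for an operator given by its graph

A (possibly unbounded) linear operator `A` with domain `D(A) ⊆ H` is represented by its graph
`G = {(u, A u) | u ∈ D(A)} ⊆ H × H`. -/

section Spectral

variable {H : Type*} [NormedAddCommGroup H] [NormedSpace ℂ H]

/-- The resolvent set: those `z` for which `A - z : D(A) → H` is a bijection with bounded
inverse `R`. -/
def resolventSet (G : Set (H × H)) : Set ℂ :=
  {z | ∃ R : H →L[ℂ] H, (∀ f : H, (R f, f + z • R f) ∈ G) ∧
    ∀ u v : H, (u, v) ∈ G → R (v - z • u) = u}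

/-- The spectrum. -/
def opSpectrum (G : Set (H × H)) : Set ℂ := (resolventSet G)ᶜ

/-- The set of solutions `u ∈ D(A)` of `A u = z u`. -/
def eigenvectors (G : Set (H × H)) (z : ℂ) : Set H := {u | (u, z • u) ∈ G}

/-- `z` is an eigenvalue of `A`. -/
def IsEigenvalue (G : Set (H × H)) (z : ℂ) : Prop := ∃ u ∈ eigenvectors G z, u ≠ 0

/-- The discrete spectrum: isolated points of the spectrum which are eigenvalues of finite
multiplicity. -/
def discreteSpectrum (G : Set (H × H)) : Set ℂ :=
  {z | IsEigenvalue G z ∧ (∃ U ∈ 𝓝 z, U ∩ opSpectrum G = {z}) ∧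
    FiniteDimensional ℂ (Submodule.span ℂ (eigenvectors G z))}

/-- The essential spectrum: the complement of the discrete spectrum in the spectrum. -/
def essentialSpectrum (G : Set (H × H)) : Set ℂ := opSpectrum G \ discreteSpectrum G

end Spectral

/-! ### The Sobolev space `H¹` of the quarter plane -/

/-- The open quarter plane `{(x, y) | x > 0, y > 0}`. -/
def quadrant : Set (ℝ × ℝ) := Ioi 0 ×ˢ Ioi 0

/-- The Hilbert space `L²(ℝ₊²)` of complex-valued functions. -/
abbrev L2Quadrant : Type := Lp ℂ 2 ((volume : Measure (ℝ × ℝ)).restrict quadrant)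

/-- Test functions: real-valued elements of `C_c^∞` of the open quarter plane. -/
def IsTestFunction (η : ℝ × ℝ → ℝ) : Prop :=
  ContDiff ℝ ∞ η ∧ HasCompactSupport η ∧ tsupport η ⊆ quadrant

/-- `g` is the weak derivative of `φ` in the direction `v`. -/
def IsWeakDeriv (v : ℝ × ℝ) (φ g : L2Quadrant) : Prop :=
  ∀ η : ℝ × ℝ → ℝ, IsTestFunction η →
    ∫ p in quadrant, (fderiv ℝ η p v) • φ p = -∫ p in quadrant, η p • g p

/-- The Sobolev space `H¹(ℝ₊²)`. -/
def SobolevH1 : Set L2Quadrant :=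
  {φ | (∃ g, IsWeakDeriv (1, 0) φ g) ∧ ∃ g, IsWeakDeriv (0, 1) φ g}

open Classical in
/-- The weak derivative in the direction `v` (an element of `L²`, unique where it exists; `0` if
there is none). -/
def weakDeriv (v : ℝ × ℝ) (φ : L2Quadrant) : L2Quadrant :=
  if h : ∃ g, IsWeakDeriv v φ g then h.choose else 0

/-! ### Traces

For `φ ∈ H¹(ℝ₊²)`, on almost every line parallel to a coordinate axis `φ` agrees almost everywhere
with an absolutely continuous function that extends continuously to the end point of the line; the
trace is the value of that continuous function, which is recovered from `φ` as a limit of averages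
along the line.  These limits exist for almost every `y > 0` and do not depend, up to null sets,
on the representative of `φ`. -/

/-- The boundary value `φ(y, 0)`. -/
def traceBottom (φ : L2Quadrant) (y : ℝ) : ℂ :=
  limUnder (𝓝[>] (0 : ℝ)) fun h : ℝ => h⁻¹ • ∫ t in Ioc 0 h, φ (y, t)

/-- The boundary value `φ(0, y)`. -/
def traceLeft (φ : L2Quadrant) (y : ℝ) : ℂ :=
  limUnder (𝓝[>] (0 : ℝ)) fun h : ℝ => h⁻¹ • ∫ t in Ioc 0 h, φ (t, y)

/-- The trace `φ(y, y)` on the diagonal. -/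
def traceDiag (φ : L2Quadrant) (y : ℝ) : ℂ :=
  limUnder (𝓝[>] (0 : ℝ)) fun h : ℝ => (2 * h)⁻¹ • ∫ t in Ioc (y - h) (y + h), φ (y, t)

/-! ### The form and its operator -/

/-- The sesquilinear form (antilinear in `ψ`, linear in `φ`) whose quadratic form is
`q[φ] = ∫ |∇φ|² - ∫ σ(y) (|φ(y,0)|² + |φ(0,y)|²) dy + ∫ α(y) |φ(y,y)|² dy`; its form domain is
`SobolevH1`. -/
def form (σ α : ℝ → ℝ) (ψ φ : L2Quadrant) : ℂ :=
  (∫ p in quadrant, (conj (weakDeriv (1, 0) ψ p) * weakDeriv (1, 0) φ p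
      + conj (weakDeriv (0, 1) ψ p) * weakDeriv (0, 1) φ p))
    - (∫ y in Ioi (0 : ℝ), (σ y : ℂ) *
        (conj (traceBottom ψ y) * traceBottom φ y + conj (traceLeft ψ y) * traceLeft φ y))
    + ∫ y in Ioi (0 : ℝ), (α y : ℂ) * (conj (traceDiag ψ y) * traceDiag φ y)

/-- The operator `-Δ` associated with the form, given by its graph: `φ` is in its domain with
image `f` iff `φ` is in the form domain and `q(ψ, φ) = ⟪ψ, f⟫` for all `ψ` in the form domain. -/
def hamiltonian (σ α : ℝ → ℝ) : Set (L2Quadrant × L2Quadrant) :=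
  {u | u.1 ∈ SobolevH1 ∧ ∀ ψ ∈ SobolevH1, form σ α ψ u.1 = inner ℂ ψ u.2}

end

end TwoParticle

/-!
Only the existence of a negative real point `E` of the spectrum has to be shown: the essential
spectrum has no negative real point, so `E` then lies in the discrete spectrum and is an
eigenvalue.

Such a point is the infimum `m` of the Rayleigh quotient of the form `q`
(`exists_neg_mem_opSpectrum_of_form`). A bounded inverse `R` of `A - m` would improve the lower
bound `q ≥ m` to `q ≥ m + M⁻¹` with `M ≥ ‖R‖`, by nonnegativity of `q - m` at `ψ - M⁻¹ R ψ`. This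
needs that `q` expands as a quadratic form on `H¹` (`form_re_add_smul`), that it is bounded below
(`exists_form_lower_bound`), and that it takes a negative value (`exists_form_neg`).

The first two points rest on the traces. An `H¹` function agrees on almost every line with a
continuous primitive of its weak derivative (`HasWeakDerivSnd.exists_primitive`). This is deduced
from the identity `f (p + (0, h)) - f p = ∫_0^h g (p + (0, s)) ds` for almost every `p`, which only
uses translates of test functions (`HasWeakDerivSnd.ae_increment`). Hence the limits of averages
that define the traces exist almost everywhere and depend linearly on the function, and the
one-dimensional Sobolev inequality on lines (`sq_norm_primitive_le`) gives the trace inequality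
`∫ |T φ|² ≤ 2 (ε⁻¹ ‖φ‖² + ε ‖∇φ‖²)` for every `ε > 0`. With small `ε`, the terms with the bounded
weights `σ` and `α` are absorbed into the gradient term.

For the third point the trial functions are `N⁻¹ ∑_{k < N} exp (-r 2^k (x + y))`. In two dimensions
the Dirichlet energy is invariant under scaling, and the summands live on different scales and
are almost orthogonal, so the energy is at most `6 / N` for every `r` (`sum_dyadic_gram_le`). As
`r → 0` the trial function tends to `1` boundedly, and the boundary and diagonal terms tend to
`-∫ (2σ - α) < 0`.
-/

namespace TwoParticle

/-! ### The bottom of the form lies in the spectrum -/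

/-- If a form that is bounded below takes a negative value, then the operator associated with it
has a negative real point in its spectrum, namely the infimum `m` of the Rayleigh quotient. If
`R` were a bounded inverse of `A - m` and `M ≥ ‖R‖`, the nonnegativity of `B - m` at
`ψ - M⁻¹ R ψ` would read `B[ψ] ≥ (m + M⁻¹) ‖ψ‖²`. This
contradicts the choice of `m`. -/
theorem exists_neg_mem_opSpectrum_of_form {H : Type*} [NormedAddCommGroup H]
    [InnerProductSpace ℂ H] (D : Set H) (B : H → H → ℂ)
    (hD : ∀ ψ ∈ D, ∀ χ ∈ D, ∀ t : ℝ, ψ + t • χ ∈ D)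
    (hB : ∀ ψ ∈ D, ∀ χ ∈ D, ∀ t : ℝ, (B (ψ + t • χ) (ψ + t • χ)).re =
      (B ψ ψ).re + 2 * t * (B ψ χ).re + t ^ 2 * (B χ χ).re)
    (C : ℝ) (hC : ∀ φ ∈ D, -C * ‖φ‖ ^ 2 ≤ (B φ φ).re)
    (φ₀ : H) (hφ₀ : φ₀ ∈ D) (hneg : (B φ₀ φ₀).re < 0) :
    ∃ E : ℝ, E < 0 ∧
      (E : ℂ) ∈ opSpectrum {u : H × H | u.1 ∈ D ∧ ∀ ψ ∈ D, B ψ u.1 = inner ℂ ψ u.2} := by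
  have hφ₀0 : φ₀ ≠ 0 := by
    rintro rfl
    have := hC 0 hφ₀
    simp at this
    linarith
  set S : Set ℝ := {r | ∃ φ ∈ D, φ ≠ 0 ∧ r = (B φ φ).re / ‖φ‖ ^ 2} with hS
  have hbdd : BddBelow S := by
    refine ⟨-C, ?_⟩
    rintro r ⟨φ, hφ, h0, rfl⟩
    have : 0 < ‖φ‖ ^ 2 := by positivity
    rw [le_div_iff₀ this]
    exact hC φ hφ
  have hne : S.Nonempty := ⟨_, φ₀, hφ₀, hφ₀0, rfl⟩
  set m := sInf S with hm
  have hm_le : ∀ φ ∈ D, m * ‖φ‖ ^ 2 ≤ (B φ φ).re := by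
    intro φ hφ
    by_cases h0 : φ = 0
    · have := hC φ hφ
      simpa [h0] using this
    · have : 0 < ‖φ‖ ^ 2 := by positivity
      rw [← le_div_iff₀ this]
      exact csInf_le hbdd ⟨φ, hφ, h0, rfl⟩
  have hm_neg : m < 0 := by
    refine lt_of_le_of_lt (csInf_le hbdd ⟨φ₀, hφ₀, hφ₀0, rfl⟩) ?_
    exact div_neg_of_neg_of_pos hneg (by positivity)
  refine ⟨m, hm_neg, ?_⟩
  rintro ⟨R, hR, -⟩
  set M : ℝ := ‖R‖ + 1 with hM
  have hMpos : 0 < M := by positivity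
  have key : ∀ ψ ∈ D, (m + M⁻¹) * ‖ψ‖ ^ 2 ≤ (B ψ ψ).re := by
    intro ψ hψ
    obtain ⟨hRD, hRB⟩ := hR ψ
    simp only at hRD hRB
    have h1 := hm_le _ (hD ψ hψ (R ψ) hRD (-M⁻¹))
    rw [hB ψ hψ (R ψ) hRD (-M⁻¹), hRB ψ hψ, hRB _ hRD] at h1
    have h2 : ‖ψ + (-M⁻¹) • R ψ‖ ^ 2 =
        ‖ψ‖ ^ 2 + 2 * (-M⁻¹) * (inner ℂ ψ (R ψ)).re + M⁻¹ ^ 2 * ‖R ψ‖ ^ 2 := by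
      rw [@norm_add_sq ℂ, norm_smul, ← Complex.coe_smul, inner_smul_right]
      simp [abs_of_pos hMpos]
      ring_nf
    have h3 : (inner ℂ ψ (ψ + (m : ℂ) • R ψ)).re = ‖ψ‖ ^ 2 + m * (inner ℂ ψ (R ψ)).re := by
      rw [inner_add_right, inner_smul_right, inner_self_eq_norm_sq_to_K]
      simp [← Complex.ofReal_pow]
    have h4 : (inner ℂ (R ψ) (ψ + (m : ℂ) • R ψ)).re =
        (inner ℂ (R ψ) ψ).re + m * ‖R ψ‖ ^ 2 := by
      rw [inner_add_right, inner_smul_right, inner_self_eq_norm_sq_to_K]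
      simp [← Complex.ofReal_pow]
    have h5 : (inner ℂ (R ψ) ψ).re ≤ M * ‖ψ‖ ^ 2 := by
      have a1 : (inner ℂ (R ψ) ψ).re ≤ ‖R ψ‖ * ‖ψ‖ := re_inner_le_norm (𝕜 := ℂ) _ _
      have a2 : ‖R ψ‖ * ‖ψ‖ ≤ (‖R‖ * ‖ψ‖) * ‖ψ‖ := by
        gcongr
        exact R.le_opNorm ψ
      nlinarith [sq_nonneg ‖ψ‖]
    rw [h2, h3, h4] at h1
    have h6 : M⁻¹ ^ 2 * (inner ℂ (R ψ) ψ).re ≤ M⁻¹ * ‖ψ‖ ^ 2 := by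
      calc M⁻¹ ^ 2 * (inner ℂ (R ψ) ψ).re ≤ M⁻¹ ^ 2 * (M * ‖ψ‖ ^ 2) := by gcongr
        _ = M⁻¹ * ‖ψ‖ ^ 2 := by field_simp
    nlinarith
  have : m + M⁻¹ ≤ m := by
    apply le_csInf hne
    rintro r ⟨φ, hφ, h0, rfl⟩
    have : 0 < ‖φ‖ ^ 2 := by positivity
    rw [le_div_iff₀ this]
    exact key φ hφ
  have : 0 < M⁻¹ := by positivity
  linarith

/-! ### Weak derivatives on lines -/

lemma isOpen_quadrant : IsOpen quadrant := isOpen_Ioi.prod isOpen_Ioi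

lemma measurableSet_quadrant : MeasurableSet quadrant := isOpen_quadrant.measurableSet

/-- The measure `dx dy` on the quarter plane. -/
noncomputable abbrev quadMeasure : Measure (ℝ × ℝ) := (volume : Measure (ℝ × ℝ)).restrict quadrant

lemma quadMeasure_eq_prod : quadMeasure =
    ((volume : Measure ℝ).restrict (Ioi 0)).prod ((volume : Measure ℝ).restrict (Ioi 0)) := by
  rw [Measure.prod_restrict]
  rfl

/-- `g` is the weak derivative of `f` in the second variable on the quarter plane, for functions
rather than for classes of functions. -/
def HasWeakDerivSnd (f g : ℝ × ℝ → ℂ) : Prop :=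
  ∀ η : ℝ × ℝ → ℝ, IsTestFunction η →
    ∫ p in quadrant, (fderiv ℝ η p (0, 1)) • f p = -∫ p in quadrant, η p • g p

lemma integral_quadrant_smul (a : ℝ × ℝ → ℝ) (f : ℝ × ℝ → ℂ) :
    ∫ p in quadrant, a p • f p = ∫ p, a p • quadrant.indicator f p := by
  rw [← integral_indicator measurableSet_quadrant]
  congr 1
  ext p
  by_cases hp : p ∈ quadrant <;> simp [hp]

/-- Test functions are stable under translation away from the boundary. -/
lemma IsTestFunction.translate {η : ℝ × ℝ → ℝ} (hη : IsTestFunction η) {s : ℝ} (hs : 0 ≤ s) :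
    IsTestFunction fun p => η (p - (0, s)) := by
  obtain ⟨h1, h2, h3⟩ := hη
  refine ⟨h1.comp (contDiff_id.sub contDiff_const), ?_, ?_⟩
  · exact h2.comp_homeomorph (Homeomorph.subRight ((0 : ℝ), s))
  · have : tsupport (fun p => η (p - (0, s))) ⊆ (fun p => p - ((0 : ℝ), s)) ⁻¹' tsupport η :=
      closure_minimal (fun p hp => subset_closure hp)
        ((isClosed_tsupport η).preimage (by fun_prop))
    intro p hp
    have := h3 (this hp)
    simp only [quadrant, mem_prod, mem_Ioi, Prod.fst_sub, Prod.snd_sub, sub_zero] at this ⊢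
    exact ⟨this.1, by linarith [this.2]⟩

/-- The shear `(s, p) ↦ (s, p + (0, s))` preserves the product measure. -/
lemma measurePreserving_shear (ν : Measure ℝ) [SFinite ν] :
    MeasurePreserving (fun z : ℝ × (ℝ × ℝ) => (z.1, z.2 + (0, z.1)))
      (ν.prod volume) (ν.prod volume) := by
  refine (MeasurePreserving.id ν).skew_product
    (g := fun s p => p + ((0 : ℝ), s)) (by fun_prop) ?_
  filter_upwards with s
  exact (measurePreserving_add_right volume ((0 : ℝ), s)).map_eq

/-- Integrability on the product, as required to exchange the integrals over `p` and over the
length `s` of the translation: for `s ∈ (0, h]` the supports of the translates of `θ` lie in one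
compact set. -/
lemma integrable_translate_smul {F : ℝ × ℝ → ℂ} (hF : LocallyIntegrable F volume) (h : ℝ)
    {θ : ℝ × ℝ → ℝ} (hθ : Measurable θ) {C : ℝ} (hC : ∀ p, ‖θ p‖ ≤ C) {k : Set (ℝ × ℝ)}
    (hk : IsCompact k) (hθk : ∀ p, p ∉ k → θ p = 0) :
    Integrable (fun z : ℝ × (ℝ × ℝ) => θ (z.2 - (0, z.1)) • F z.2)
      (((volume : Measure ℝ).restrict (Ioc 0 h)).prod volume) := by
  set k' : Set (ℝ × ℝ) := (fun z : ℝ × (ℝ × ℝ) => z.2 + (0, z.1)) '' (Icc 0 h ×ˢ k) with hk'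
  have hk'c : IsCompact k' := (isCompact_Icc.prod hk).image (by fun_prop)
  have hC0 : 0 ≤ C := (norm_nonneg _).trans (hC 0)
  have h1 : Integrable (k'.indicator F) volume :=
    (hF.integrableOn_isCompact hk'c).integrable_indicator hk'c.measurableSet
  have h2 := (h1.norm.const_mul C).comp_snd ((volume : Measure ℝ).restrict (Ioc 0 h))
  refine h2.mono ?_ ?_
  · refine AEStronglyMeasurable.smul (𝕜 := ℝ) ?_ hF.aestronglyMeasurable.comp_snd
    have : Measurable fun z : ℝ × (ℝ × ℝ) => θ (z.2 - (0, z.1)) := hθ.comp (by fun_prop)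
    exact this.aestronglyMeasurable
  · have h3 : ∀ᵐ z : ℝ × (ℝ × ℝ) ∂(((volume : Measure ℝ).restrict (Ioc 0 h)).prod volume),
        z.1 ∈ Ioc 0 h :=
      (Measure.quasiMeasurePreserving_fst
        (μ := (volume : Measure ℝ).restrict (Ioc 0 h))).ae (ae_restrict_mem measurableSet_Ioc)
    filter_upwards [h3] with z hz
    rw [norm_smul, Real.norm_of_nonneg (mul_nonneg hC0 (norm_nonneg _))]
    by_cases hzk : z.2 ∈ k'
    · rw [indicator_of_mem hzk]
      exact mul_le_mul_of_nonneg_right (hC _) (norm_nonneg _)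
    · have : z.2 - (0, z.1) ∉ k := fun hmem =>
        hzk ⟨(z.1, z.2 - (0, z.1)), ⟨Ioc_subset_Icc_self hz, hmem⟩, by simp⟩
      rw [hθk _ this]
      simp
      positivity

lemma integrable_smul_translate {F : ℝ × ℝ → ℂ} (hF : LocallyIntegrable F volume) (h : ℝ)
    {θ : ℝ × ℝ → ℝ} (hθ : Measurable θ) {C : ℝ} (hC : ∀ p, ‖θ p‖ ≤ C) {k : Set (ℝ × ℝ)}
    (hk : IsCompact k) (hθk : ∀ p, p ∉ k → θ p = 0) :
    Integrable (fun z : ℝ × (ℝ × ℝ) => θ z.2 • F (z.2 + (0, z.1)))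
      (((volume : Measure ℝ).restrict (Ioc 0 h)).prod volume) := by
  have hs := measurePreserving_shear ((volume : Measure ℝ).restrict (Ioc 0 h))
  have := hs.integrable_comp_of_integrable
    (integrable_translate_smul hF h hθ hC hk hθk)
  refine this.congr (ae_of_all _ fun z => ?_)
  simp

lemma locallyIntegrable_segment {G : ℝ × ℝ → ℂ} (hG : LocallyIntegrable G volume) (h : ℝ) :
    LocallyIntegrable (fun p : ℝ × ℝ => ∫ s in Ioc 0 h, G (p + (0, s))) volume := by
  rw [locallyIntegrable_iff]
  intro k hk
  have h1 := integrable_smul_translate hG h (θ := k.indicator 1) (C := 1) (k := k)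
    (measurable_one.indicator hk.measurableSet)
    (fun p => by by_cases hp : p ∈ k <;> simp [hp]) hk (fun p hp => by simp [hp])
  rw [← integrable_indicator_iff hk.measurableSet]
  refine h1.integral_prod_right.congr (ae_of_all _ fun p => ?_)
  by_cases hp : p ∈ k <;> simp [hp]

/-- For `h ≥ 0` the increment of `f` over vertical segments of length `h` is the integral of its
weak derivative. Testing the increment against `η` puts the difference `η (p - (0, h)) - η p` on
`f`; this difference is an integral of derivatives of translates of `η`, which are again test
functions. -/
lemma HasWeakDerivSnd.ae_increment {f g : ℝ × ℝ → ℂ} (hfg : HasWeakDerivSnd f g)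
    (hf : MemLp f 2 quadMeasure) (hg : MemLp g 2 quadMeasure) {h : ℝ} (hh : 0 ≤ h) :
    ∀ᵐ p ∂quadMeasure, f (p + (0, h)) - f p = ∫ s in Ioc 0 h, g (p + (0, s)) := by
  set F := quadrant.indicator f with hF
  set G := quadrant.indicator g with hG
  have hFL : MemLp F 2 volume := (memLp_indicator_iff_restrict measurableSet_quadrant).2 hf
  have hGL : MemLp G 2 volume := (memLp_indicator_iff_restrict measurableSet_quadrant).2 hg
  have hFloc : LocallyIntegrable F volume := hFL.locallyIntegrable (by norm_num)
  have hGloc : LocallyIntegrable G volume := hGL.locallyIntegrable (by norm_num)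
  have hFh : LocallyIntegrable (fun p => F (p + (0, h))) volume :=
    MemLp.locallyIntegrable (hFL.comp_measurePreserving
      (measurePreserving_add_right volume ((0 : ℝ), h))) (by norm_num)
  have hKloc := locallyIntegrable_segment hGloc h
  have hzero : ∀ᵐ p : ℝ × ℝ, p ∈ quadrant →
      F (p + (0, h)) - F p - ∫ s in Ioc 0 h, G (p + (0, s)) = 0 := by
    refine isOpen_quadrant.ae_eq_zero_of_integral_contDiff_smul_eq_zero
      (((hFh.sub hFloc).sub hKloc).locallyIntegrableOn _) ?_
    intro η hη1 hη2 hη3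
    have hη : IsTestFunction η := ⟨hη1, hη2, hη3⟩
    have hηdiff : Differentiable ℝ η := hη1.differentiable (by simp)
    have hηc := hη1.continuous
    set θ : ℝ × ℝ → ℝ := fun p => fderiv ℝ η p (0, 1) with hθ
    have hθc : Continuous θ := (hη1.continuous_fderiv (by simp)).clm_apply continuous_const
    have hθs : HasCompactSupport θ := hη2.fderiv_apply (𝕜 := ℝ) (0, 1)
    obtain ⟨Cη, hCη⟩ := hη2.exists_bound_of_continuous hηc
    obtain ⟨Cθ, hCθ⟩ := hθs.exists_bound_of_continuous hθc
    have hkη : ∀ p, p ∉ tsupport η → η p = 0 := fun p hp => image_eq_zero_of_notMem_tsupport hp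
    have hkθ : ∀ p, p ∉ tsupport θ → θ p = 0 := fun p hp => image_eq_zero_of_notMem_tsupport hp
    have i1 : Integrable (fun p => η p • F (p + (0, h))) volume :=
      hFh.integrable_smul_left_of_hasCompactSupport hηc hη2
    have i2 : Integrable (fun p => η p • F p) volume :=
      hFloc.integrable_smul_left_of_hasCompactSupport hηc hη2
    have i3 : Integrable (fun p => η p • ∫ s in Ioc 0 h, G (p + (0, s))) volume :=
      hKloc.integrable_smul_left_of_hasCompactSupport hηc hη2
    have hηh := hη.translate hh
    have i4 : Integrable (fun p => η (p - (0, h)) • F p) volume :=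
      hFloc.integrable_smul_left_of_hasCompactSupport hηh.1.continuous hηh.2.1
    have e1 : ∫ p, η p • F (p + (0, h)) = ∫ p, η (p - (0, h)) • F p := by
      rw [← integral_add_right_eq_self (fun p => η (p - (0, h)) • F p) ((0 : ℝ), h)]
      simp
    have e2 : ∫ p, η p • (∫ s in Ioc 0 h, G (p + (0, s))) =
        ∫ s in Ioc 0 h, ∫ p, η p • G (p + (0, s)) := by
      simp_rw [← integral_smul]
      exact integral_integral_swap (f := fun p s => η p • G (p + (0, s)))
        (integrable_smul_translate hGloc h hηc.measurable hCη hη2 hkη).swap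
    have e3 : ∀ s ∈ Ioc 0 h, ∫ p, η p • G (p + (0, s)) = -∫ p, θ (p - (0, s)) • F p := by
      intro s hs
      rw [← integral_sub_right_eq_self (fun p => η p • G (p + (0, s))) ((0 : ℝ), s)]
      simp only [sub_add_cancel]
      rw [hG, ← integral_quadrant_smul (fun p => η (p - (0, s))),
        ← neg_eq_iff_eq_neg.2 (hfg _ (hη.translate hs.1.le)), hF,
        ← integral_quadrant_smul (fun p => θ (p - (0, s)))]
      simp only [hθ, fderiv_comp_sub]
    have e4 : ∫ s in Ioc 0 h, ∫ p, η p • G (p + (0, s)) =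
        -∫ s in Ioc 0 h, ∫ p, θ (p - (0, s)) • F p := by
      rw [← integral_neg]
      exact setIntegral_congr_fun measurableSet_Ioc e3
    have e5 : ∫ s in Ioc 0 h, ∫ p, θ (p - (0, s)) • F p =
        ∫ p, (∫ s in Ioc 0 h, θ (p - (0, s))) • F p := by
      rw [integral_integral_swap (f := fun s p => θ (p - (0, s)) • F p)
        (integrable_translate_smul hFloc h hθc.measurable hCθ hθs hkθ)]
      simp_rw [integral_smul_const]
    have e6 : ∀ p, ∫ s in Ioc 0 h, θ (p - (0, s)) = η p - η (p - (0, h)) := by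
      intro p
      have hd : ∀ s : ℝ, HasDerivAt (fun s : ℝ => -η (p - (0, s))) (θ (p - (0, s))) s := by
        intro s
        have a : HasDerivAt (fun s : ℝ => p - ((0 : ℝ), s)) (-((0 : ℝ), (1 : ℝ))) s :=
          ((hasDerivAt_const s (0 : ℝ)).prodMk (hasDerivAt_id s)).const_sub p
        have b := ((hηdiff (p - (0, s))).hasFDerivAt.comp_hasDerivAt s a).neg
        rw [map_neg, neg_neg] at b
        exact b
      rw [← intervalIntegral.integral_of_le hh,
        intervalIntegral.integral_eq_sub_of_hasDerivAt (fun s _ => hd s)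
          ((hθc.comp (by fun_prop)).intervalIntegrable _ _)]
      have : p - ((0 : ℝ), (0 : ℝ)) = p := by ext <;> simp
      rw [this]
      ring
    simp_rw [smul_sub]
    rw [integral_sub (by exact i1.sub i2) i3, integral_sub i1 i2, e1, e2, e4, e5]
    simp_rw [e6, sub_smul]
    rw [integral_sub i2 i4]
    ring
  rw [ae_restrict_iff' measurableSet_quadrant]
  filter_upwards [hzero] with p hp hpQ
  have hmem : ∀ s : ℝ, 0 ≤ s → p + (0, s) ∈ quadrant := fun s hs => by
    obtain ⟨h1, h2⟩ := hpQ
    refine ⟨by simpa using h1, ?_⟩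
    simp only [mem_Ioi, Prod.snd_add] at h2 ⊢
    linarith
  have h1 := hp hpQ
  rw [hF, indicator_of_mem hpQ, indicator_of_mem (hmem h hh), sub_eq_zero] at h1
  rw [h1]
  refine setIntegral_congr_fun measurableSet_Ioc fun s hs => ?_
  simp only [hG, indicator_of_mem (hmem s hs.1.le)]

/-- On almost every vertical line an `L²` function on the quarter plane is square integrable. -/
lemma ae_memLp_fiber {f : ℝ × ℝ → ℂ} (hf : MemLp f 2 quadMeasure) :
    ∀ᵐ x ∂(volume.restrict (Ioi (0 : ℝ))),
      MemLp (fun t => f (x, t)) 2 (volume.restrict (Ioi (0 : ℝ))) := by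
  rw [quadMeasure_eq_prod] at hf
  have h2 := ((memLp_two_iff_integrable_sq_norm hf.1).1 hf).prod_right_ae
  filter_upwards [h2, hf.1.prodMk_left] with x hx hm
  exact (memLp_two_iff_integrable_sq_norm hm).2 hx

lemma integrableOn_Ioc_of_memLp {u : ℝ → ℂ} (hu : MemLp u 2 (volume.restrict (Ioi (0 : ℝ))))
    {a : ℝ} (ha : 0 ≤ a) (b : ℝ) : IntegrableOn u (Ioc a b) := by
  have h : MemLp u 2 (volume.restrict (Ioc a b)) :=
    hu.mono_measure (Measure.restrict_mono (fun t ht => lt_of_le_of_lt ha ht.1) le_rfl)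
  exact h.integrable (by norm_num)

/-- A function that is invariant under almost every translation, from almost every starting point,
is almost everywhere constant: it equals `w t` almost everywhere beyond `t`, for starting points
`t` arbitrarily close to `0`. -/
lemma exists_ae_eq_const_of_ae_translate {w : ℝ → ℂ}
    (hw : ∀ᵐ t ∂(volume.restrict (Ioi (0 : ℝ))), ∀ᵐ h ∂(volume.restrict (Ioi (0 : ℝ))),
      w (t + h) = w t) :
    ∃ c, ∀ᵐ t ∂(volume.restrict (Ioi (0 : ℝ))), w t = c := by
  have hex : ∀ n : ℕ, ∃ t ∈ Ioo (0 : ℝ) (1 / (n + 1)), ∀ᵐ s, t < s → w s = w t := by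
    intro n
    have hpos : (0 : ℝ) < 1 / (n + 1) := by positivity
    have h1 : ∀ᵐ t ∂(volume.restrict (Ioo (0 : ℝ) (1 / (n + 1)))),
        t ∈ Ioo (0 : ℝ) (1 / (n + 1)) ∧
          ∀ᵐ h ∂(volume.restrict (Ioi (0 : ℝ))), w (t + h) = w t := by
      refine (ae_restrict_mem measurableSet_Ioo).and ?_
      exact ae_mono (Measure.restrict_mono (fun t ht => ht.1) le_rfl) hw
    have hne : (ae (volume.restrict (Ioo (0 : ℝ) (1 / (n + 1))))).NeBot := by
      rw [ae_neBot, Ne, Measure.restrict_eq_zero]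
      simp [Real.volume_Ioo, -one_div]
      positivity
    obtain ⟨t, ht, hth⟩ := h1.exists
    refine ⟨t, ht, ?_⟩
    rw [ae_restrict_iff' measurableSet_Ioi] at hth
    have h2 := (measurePreserving_sub_right volume t).quasiMeasurePreserving.ae hth
    filter_upwards [h2] with s hs hts
    have := hs (by simpa using hts)
    simpa using this
  choose t ht hts using hex
  have hconst : ∀ n, w (t n) = w (t 0) := by
    intro n
    have h1 := (hts n).and (hts 0)
    have hne : (ae (volume.restrict (Ioi (max (t n) (t 0))))).NeBot := by
      rw [ae_neBot, Ne, Measure.restrict_eq_zero]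
      simp
    obtain ⟨s, hs1, hs2⟩ := ((ae_restrict_of_ae h1).and (ae_restrict_mem
      (μ := volume) (measurableSet_Ioi (a := max (t n) (t 0))))).exists
    rw [← hs1.1 (lt_of_le_of_lt (le_max_left _ _) hs2),
      ← hs1.2 (lt_of_le_of_lt (le_max_right _ _) hs2)]
  refine ⟨w (t 0), ?_⟩
  rw [ae_restrict_iff' measurableSet_Ioi]
  filter_upwards [ae_all_iff.2 hts] with s hs hs0
  obtain ⟨n, hn⟩ := exists_nat_one_div_lt (show (0 : ℝ) < s from hs0)
  rw [hs n ((ht n).2.trans hn), hconst n]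

lemma stronglyMeasurable_integral_vertical {g : ℝ × ℝ → ℂ} (hg : StronglyMeasurable g)
    {a b : ℝ × ℝ → ℝ} (ha : Measurable a) (hb : Measurable b) :
    StronglyMeasurable fun p : ℝ × ℝ => ∫ s in Ioc (a p) (b p), g (p.1, s) := by
  have hset : MeasurableSet {z : (ℝ × ℝ) × ℝ | a z.1 < z.2 ∧ z.2 ≤ b z.1} :=
    (measurableSet_lt (ha.comp measurable_fst) measurable_snd).inter
      (measurableSet_le measurable_snd (hb.comp measurable_fst))
  have h1 : StronglyMeasurable
      ({z : (ℝ × ℝ) × ℝ | a z.1 < z.2 ∧ z.2 ≤ b z.1}.indicator fun z => g (z.1.1, z.2)) :=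
    (hg.comp_measurable (by fun_prop)).indicator hset
  convert h1.integral_prod_right' (ν := volume) using 2 with p
  rw [← integral_indicator measurableSet_Ioc]
  rfl

/-- A square integrable function with square integrable weak derivative `g` in the second variable
agrees on almost every vertical line almost everywhere with the absolutely continuous function
`c + ∫_0^t g`. -/
lemma HasWeakDerivSnd.exists_primitive {f g : ℝ × ℝ → ℂ} (hfg : HasWeakDerivSnd f g)
    (hf : MemLp f 2 quadMeasure) (hg : MemLp g 2 quadMeasure)
    (hfm : StronglyMeasurable f) (hgm : StronglyMeasurable g) :
    ∀ᵐ x ∂(volume.restrict (Ioi (0 : ℝ))), ∃ c : ℂ,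
      ∀ᵐ t ∂(volume.restrict (Ioi (0 : ℝ))), f (x, t) = c + ∫ s in Ioc 0 t, g (x, s) := by
  set w : ℝ × ℝ → ℂ := fun p => f p - ∫ s in Ioc 0 p.2, g (p.1, s) with hw
  have hwm : StronglyMeasurable w :=
    hfm.sub (stronglyMeasurable_integral_vertical hgm measurable_const measurable_snd)
  -- the increment formula says that `w` is invariant under vertical translations
  have h1 : ∀ h ∈ Ioi (0 : ℝ), ∀ᵐ p ∂quadMeasure, w (p + (0, h)) = w p := by
    intro h hh
    have h2 := hfg.ae_increment hf hg (le_of_lt hh)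
    have h3 : ∀ᵐ p ∂quadMeasure, 0 < p.2 ∧
        MemLp (fun t => g (p.1, t)) 2 (volume.restrict (Ioi (0 : ℝ))) := by
      refine Eventually.and ?_ ?_
      · filter_upwards [ae_restrict_mem measurableSet_quadrant] with p hp using hp.2
      · rw [quadMeasure_eq_prod]
        exact Measure.quasiMeasurePreserving_fst.ae (ae_memLp_fiber hg)
    filter_upwards [h2, h3] with p hp hp3
    have i1 := integrableOn_Ioc_of_memLp hp3.2 le_rfl p.2
    have i2 := integrableOn_Ioc_of_memLp hp3.2 hp3.1.le (p.2 + h)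
    have e1 : ∫ s in Ioc 0 h, g (p + (0, s)) = ∫ s in Ioc p.2 (p.2 + h), g (p.1, s) := by
      rw [← intervalIntegral.integral_of_le (le_of_lt hh),
        ← intervalIntegral.integral_of_le (by linarith [mem_Ioi.1 hh])]
      have := intervalIntegral.integral_comp_add_left (a := 0) (b := h)
        (fun s => g (p.1, s)) p.2
      rw [add_zero] at this
      rw [← this]
      congr 1
      ext s
      congr 1
      ext <;> simp
    have e2 : ∫ s in Ioc 0 (p.2 + h), g (p.1, s) =
        (∫ s in Ioc 0 p.2, g (p.1, s)) + ∫ s in Ioc p.2 (p.2 + h), g (p.1, s) := by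
      rw [← setIntegral_union (Ioc_disjoint_Ioc_of_le le_rfl) measurableSet_Ioc i1 i2,
        Ioc_union_Ioc_eq_Ioc hp3.1.le (by linarith [mem_Ioi.1 hh])]
    simp only [hw, Prod.snd_add, Prod.fst_add, add_zero]
    rw [e2, ← e1, ← hp]
    ring
  have h2 : ∀ᵐ p ∂quadMeasure, ∀ᵐ h ∂(volume.restrict (Ioi (0 : ℝ))), w (p + (0, h)) = w p := by
    -- exchanging the quantifiers over `h` and `p` uses the measurability of `w`
    have h3 : ∀ᵐ h ∂(volume.restrict (Ioi (0 : ℝ))), ∀ᵐ p ∂quadMeasure, w (p + (0, h)) = w p := by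
      filter_upwards [ae_restrict_mem measurableSet_Ioi] with h hh using h1 h hh
    rwa [Measure.ae_ae_comm] at h3
    exact measurableSet_eq_fun (hwm.measurable.comp (by fun_prop))
      (hwm.measurable.comp (by fun_prop))
  rw [quadMeasure_eq_prod] at h2
  filter_upwards [Measure.ae_ae_of_ae_prod h2] with x hx
  obtain ⟨c, hc⟩ := exists_ae_eq_const_of_ae_translate (w := fun t => w (x, t))
    (by filter_upwards [hx] with t ht; simpa using ht)
  refine ⟨c, ?_⟩
  filter_upwards [hc] with t ht
  rw [← ht]
  simp [hw]

/-! ### Absolutely continuous functions on the half-line -/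

lemma tendsto_right_average {U : ℝ → ℂ} (hU : Continuous U) :
    Tendsto (fun h : ℝ => h⁻¹ • ∫ t in Ioc 0 h, U t) (𝓝[>] 0) (𝓝 (U 0)) := by
  have hd : HasDerivAt (fun t => ∫ s in (0 : ℝ)..t, U s) (U 0) 0 :=
    intervalIntegral.integral_hasDerivAt_right (hU.intervalIntegrable _ _)
      hU.aestronglyMeasurable.stronglyMeasurableAtFilter hU.continuousAt
  have h1 := (hasDerivAt_iff_tendsto_slope_zero.1 hd).mono_left
    (nhdsWithin_mono 0 (fun h (hh : 0 < h) => ne_of_gt hh))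
  refine h1.congr' ?_
  filter_upwards [self_mem_nhdsWithin] with h hh
  simp [intervalIntegral.integral_of_le (le_of_lt hh)]

lemma tendsto_symmetric_average {U : ℝ → ℂ} (hU : Continuous U) (y : ℝ) :
    Tendsto (fun h : ℝ => (2 * h)⁻¹ • ∫ t in Ioc (y - h) (y + h), U t) (𝓝[>] 0) (𝓝 (U y)) := by
  have hd : HasDerivAt (fun t => ∫ s in (0 : ℝ)..t, U s) (U y) y :=
    intervalIntegral.integral_hasDerivAt_right (hU.intervalIntegrable _ _)
      hU.aestronglyMeasurable.stronglyMeasurableAtFilter hU.continuousAt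
  have h0 := hasDerivAt_iff_tendsto_slope_zero.1 hd
  have h1 := h0.mono_left (nhdsWithin_mono 0 (fun h (hh : 0 < h) => ne_of_gt hh))
  have hneg : Tendsto (fun h : ℝ => -h) (𝓝[>] 0) (𝓝[≠] 0) := by
    refine tendsto_nhdsWithin_iff.2 ⟨?_, ?_⟩
    · have : Tendsto (fun h : ℝ => -h) (𝓝 0) (𝓝 (-0)) := (continuous_neg).tendsto 0
      rw [neg_zero] at this
      exact this.mono_left nhdsWithin_le_nhds
    · filter_upwards [self_mem_nhdsWithin] with h hh
      simpa using ne_of_gt (mem_Ioi.1 hh)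
  have h2 := h0.comp hneg
  have h3 := (h1.add h2).const_smul (2⁻¹ : ℝ)
  have e : (2⁻¹ : ℝ) • (U y + U y) = U y := by
    rw [← two_smul ℝ (U y), smul_smul]
    norm_num
  rw [e] at h3
  refine h3.congr' ?_
  filter_upwards [self_mem_nhdsWithin] with h hh
  have hh0 : (0 : ℝ) < h := hh
  have e2 : ∫ t in Ioc (y - h) (y + h), U t =
      (∫ s in (0 : ℝ)..(y + h), U s) - ∫ s in (0 : ℝ)..(y - h), U s := by
    rw [intervalIntegral.integral_interval_sub_left (hU.intervalIntegrable _ _)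
      (hU.intervalIntegrable _ _), intervalIntegral.integral_of_le (by linarith)]
  rw [e2]
  simp only [Function.comp, ← sub_eq_add_neg, inv_neg, mul_inv]
  module

/-- The function `c + ∫_0^t v`, extended to a continuous function on `ℝ`. -/
noncomputable def primitive (c : ℂ) (v : ℝ → ℂ) (t : ℝ) : ℂ :=
  c + ∫ s in (0 : ℝ)..t, (Ioi (0 : ℝ)).indicator v s

lemma primitive_eq (c : ℂ) (v : ℝ → ℂ) {t : ℝ} (ht : 0 ≤ t) :
    primitive c v t = c + ∫ s in Ioc 0 t, v s := by
  rw [primitive, intervalIntegral.integral_of_le ht]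
  congr 1
  exact setIntegral_congr_fun measurableSet_Ioc fun s hs => indicator_of_mem (mem_Ioi.2 hs.1) v

lemma continuous_primitive {v : ℝ → ℂ} (hv : MemLp v 2 (volume.restrict (Ioi (0 : ℝ)))) (c : ℂ) :
    Continuous (primitive c v) := by
  have h1 : MemLp ((Ioi (0 : ℝ)).indicator v) 2 volume :=
    (memLp_indicator_iff_restrict measurableSet_Ioi).2 hv
  have h2 : LocallyIntegrable ((Ioi (0 : ℝ)).indicator v) volume :=
    h1.locallyIntegrable (by norm_num)
  exact continuous_const.add (intervalIntegral.continuous_primitive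
    (fun a b => (h2.integrableOn_isCompact isCompact_uIcc).intervalIntegrable) 0)

/-- Cauchy–Schwarz on an interval of length `ε`. -/
lemma sq_setIntegral_norm_le {v : ℝ → ℂ} (hv : MemLp v 2 (volume.restrict (Ioi (0 : ℝ))))
    {a ε : ℝ} (ha : 0 ≤ a) (hε : 0 < ε) :
    (∫ s in Ioc a (a + ε), ‖v s‖) ^ 2 ≤ ε * ∫ s in Ioi (0 : ℝ), ‖v s‖ ^ 2 := by
  have hsub : Ioc a (a + ε) ⊆ Ioi 0 := fun t ht => lt_of_le_of_lt ha ht.1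
  have i2 : IntegrableOn (fun s => ‖v s‖ ^ 2) (Ioi 0) :=
    (memLp_two_iff_integrable_sq_norm hv.1).1 hv
  have i2' := i2.mono_set hsub
  have i1 := (integrableOn_Ioc_of_memLp hv ha (a + ε)).norm
  set b := ∫ s in Ioc a (a + ε), ‖v s‖ with hb
  -- nonnegativity of the variance about the mean value `b / ε`
  have h0 : 0 ≤ ∫ s in Ioc a (a + ε), (‖v s‖ - b / ε) ^ 2 :=
    integral_nonneg fun s => sq_nonneg _
  have h1 : ∫ s in Ioc a (a + ε), (‖v s‖ - b / ε) ^ 2 =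
      (∫ s in Ioc a (a + ε), ‖v s‖ ^ 2) - b ^ 2 / ε := by
    have : (fun s => (‖v s‖ - b / ε) ^ 2) =
        fun s => ‖v s‖ ^ 2 - 2 * (b / ε) * ‖v s‖ + (b / ε) ^ 2 := by
      ext s
      ring
    rw [this, integral_add (by exact i2'.sub (i1.const_mul _)) (integrable_const _),
      integral_sub i2' (i1.const_mul _), integral_const_mul, ← hb]
    simp [hε.le]
    field_simp
    ring
  have h2 : ∫ s in Ioc a (a + ε), ‖v s‖ ^ 2 ≤ ∫ s in Ioi (0 : ℝ), ‖v s‖ ^ 2 :=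
    setIntegral_mono_set i2 (ae_of_all _ fun s => by positivity) hsub.eventuallyLE
  have h3 : b ^ 2 / ε ≤ ∫ s in Ioi (0 : ℝ), ‖v s‖ ^ 2 := by linarith
  rwa [div_le_iff₀' hε] at h3

/-- The Sobolev inequality on the half-line: compare `U (a)` with the values of `U` on an interval
of length `ε` to the right of `a`, and average. -/
lemma sq_norm_primitive_le {u v : ℝ → ℂ} (hu : MemLp u 2 (volume.restrict (Ioi (0 : ℝ))))
    (hv : MemLp v 2 (volume.restrict (Ioi (0 : ℝ)))) {c : ℂ}
    (huv : ∀ᵐ t ∂(volume.restrict (Ioi (0 : ℝ))), u t = primitive c v t)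
    {a ε : ℝ} (ha : 0 ≤ a) (hε : 0 < ε) :
    ‖primitive c v a‖ ^ 2 ≤ 2 * (ε⁻¹ * (∫ s in Ioi (0 : ℝ), ‖u s‖ ^ 2) +
      ε * ∫ s in Ioi (0 : ℝ), ‖v s‖ ^ 2) := by
  have hsub : Ioc a (a + ε) ⊆ Ioi 0 := fun t ht => lt_of_le_of_lt ha ht.1
  have i2 : IntegrableOn (fun s => ‖u s‖ ^ 2) (Ioi 0) :=
    (memLp_two_iff_integrable_sq_norm hu.1).1 hu
  have i1 := (integrableOn_Ioc_of_memLp hv ha (a + ε)).norm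
  have hb := sq_setIntegral_norm_le hv ha hε
  set b := ∫ s in Ioc a (a + ε), ‖v s‖ with hbdef
  have hpt : ∀ t ∈ Ioc a (a + ε), ‖primitive c v a‖ ≤ ‖primitive c v t‖ + b := by
    intro t ht
    have e : primitive c v t - primitive c v a = ∫ s in Ioc a t, v s := by
      rw [primitive_eq c v ha, primitive_eq c v (ha.trans ht.1.le),
        ← Ioc_union_Ioc_eq_Ioc ha ht.1.le,
        setIntegral_union (Ioc_disjoint_Ioc_of_le le_rfl) measurableSet_Ioc
          (integrableOn_Ioc_of_memLp hv le_rfl _) (integrableOn_Ioc_of_memLp hv ha _)]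
      ring
    have h1 : ‖∫ s in Ioc a t, v s‖ ≤ b :=
      (norm_integral_le_integral_norm _).trans
        (setIntegral_mono_set i1 (ae_of_all _ fun s => norm_nonneg _)
          (Ioc_subset_Ioc_right ht.2).eventuallyLE)
    have h2 : primitive c v a = primitive c v t - ∫ s in Ioc a t, v s := by
      rw [← e]
      ring
    calc ‖primitive c v a‖ ≤ ‖primitive c v t‖ + ‖∫ s in Ioc a t, v s‖ := by
          rw [h2]
          exact norm_sub_le _ _
      _ ≤ _ := by gcongr
  have hae : ∀ᵐ t ∂(volume.restrict (Ioc a (a + ε))),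
      ‖primitive c v a‖ ^ 2 ≤ 2 * ‖u t‖ ^ 2 + 2 * b ^ 2 := by
    filter_upwards [ae_mono (Measure.restrict_mono hsub le_rfl) huv,
      ae_restrict_mem measurableSet_Ioc] with t h1 h2
    have h3 := hpt t h2
    rw [h1]
    have h4 : ‖primitive c v a‖ ^ 2 ≤ (‖primitive c v t‖ + b) ^ 2 := by gcongr
    nlinarith [sq_nonneg (‖primitive c v t‖ - b)]
  have hint := integral_mono_ae (integrable_const _)
    (((i2.mono_set hsub).const_mul 2).add (integrable_const _)) hae
  have hmono : ∫ s in Ioc a (a + ε), ‖u s‖ ^ 2 ≤ ∫ s in Ioi (0 : ℝ), ‖u s‖ ^ 2 :=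
    setIntegral_mono_set i2 (ae_of_all _ fun s => by positivity) hsub.eventuallyLE
  simp only [Pi.add_apply] at hint
  rw [integral_add ((i2.mono_set hsub).const_mul 2) (integrable_const _), integral_const_mul] at hint
  simp [hε.le] at hint
  have h5 : ε * ‖primitive c v a‖ ^ 2 ≤
      ε * (2 * (ε⁻¹ * (∫ s in Ioi (0 : ℝ), ‖u s‖ ^ 2) +
        ε * ∫ s in Ioi (0 : ℝ), ‖v s‖ ^ 2)) := by
    have : ε * (2 * (ε⁻¹ * (∫ s in Ioi (0 : ℝ), ‖u s‖ ^ 2) +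
        ε * ∫ s in Ioi (0 : ℝ), ‖v s‖ ^ 2)) = 2 * (∫ s in Ioi (0 : ℝ), ‖u s‖ ^ 2) +
        2 * ε * (ε * ∫ s in Ioi (0 : ℝ), ‖v s‖ ^ 2) := by
      field_simp
    rw [this]
    nlinarith
  exact le_of_mul_le_mul_left h5 hε

lemma tendsto_lower_average {u U : ℝ → ℂ} (hU : Continuous U)
    (h : ∀ᵐ t ∂(volume.restrict (Ioi (0 : ℝ))), u t = U t) :
    Tendsto (fun h : ℝ => h⁻¹ • ∫ t in Ioc 0 h, u t) (𝓝[>] 0) (𝓝 (U 0)) := by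
  refine (tendsto_right_average hU).congr fun δ => ?_
  congr 1
  refine integral_congr_ae ?_
  filter_upwards [ae_mono (Measure.restrict_mono
    (fun t (ht : t ∈ Ioc 0 δ) => mem_Ioi.2 ht.1) le_rfl) h] with t ht using ht.symm

lemma tendsto_diagonal_average {u U : ℝ → ℂ} (hU : Continuous U)
    (h : ∀ᵐ t ∂(volume.restrict (Ioi (0 : ℝ))), u t = U t) {y : ℝ} (hy : 0 < y) :
    Tendsto (fun h : ℝ => (2 * h)⁻¹ • ∫ t in Ioc (y - h) (y + h), u t) (𝓝[>] 0) (𝓝 (U y)) := by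
  refine (tendsto_symmetric_average hU y).congr' ?_
  filter_upwards [nhdsWithin_le_nhds (Iio_mem_nhds hy)] with δ hδ
  congr 1
  refine integral_congr_ae ?_
  filter_upwards [ae_mono (Measure.restrict_mono
    (fun t (ht : t ∈ Ioc (y - δ) (y + δ)) => mem_Ioi.2 (by linarith [ht.1, mem_Iio.1 hδ]))
    le_rfl) h] with t ht using ht.symm

/-! ### Traces -/

/-- The limit as `h → 0+` of `k h` times the integral of `f (y, ·)` over `(a h y, b h y]`. The
boundary and diagonal traces are of this form. -/
noncomputable def fiberTrace (k : ℝ → ℝ) (a b : ℝ → ℝ → ℝ) (f : ℝ × ℝ → ℂ) (y : ℝ) : ℂ :=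
  limUnder (𝓝[>] (0 : ℝ)) fun h : ℝ => k h • ∫ t in Ioc (a h y) (b h y), f (y, t)

/-- The averages that define `fiberTrace k a b` reproduce the value at `e y` of a continuous
function which is known up to a null set of `(0, ∞)`. -/
structure IsFiberAverage (k : ℝ → ℝ) (a b : ℝ → ℝ → ℝ) (e : ℝ → ℝ) : Prop where
  measurable_left : ∀ h, Measurable (a h)
  measurable_right : ∀ h, Measurable (b h)
  nonneg : ∀ y, 0 < y → 0 ≤ e y
  tendsto : ∀ u U : ℝ → ℂ, Continuous U → (∀ᵐ t ∂(volume.restrict (Ioi (0 : ℝ))), u t = U t) →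
    ∀ y, 0 < y → Tendsto (fun h => k h • ∫ t in Ioc (a h y) (b h y), u t) (𝓝[>] 0) (𝓝 (U (e y)))

lemma isFiberAverage_lower :
    IsFiberAverage (fun h => h⁻¹) (fun _ _ => 0) (fun h _ => h) (fun _ => 0) where
  measurable_left _ := measurable_const
  measurable_right _ := measurable_const
  nonneg _ _ := le_rfl
  tendsto _ _ hU h _ _ := tendsto_lower_average hU h

lemma isFiberAverage_diagonal :
    IsFiberAverage (fun h => (2 * h)⁻¹) (fun h y => y - h) (fun h y => y + h) (fun y => y) where
  measurable_left _ := by fun_prop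
  measurable_right _ := by fun_prop
  nonneg _ hy := hy.le
  tendsto _ _ hU h _ hy := tendsto_diagonal_average hU h hy

section FiberTrace

variable {k : ℝ → ℝ} {a b : ℝ → ℝ → ℝ} {e : ℝ → ℝ}

lemma IsFiberAverage.fiberTrace_eq (hT : IsFiberAverage k a b e) {f : ℝ × ℝ → ℂ} {U : ℝ → ℂ}
    (hU : Continuous U) {y : ℝ} (hy : 0 < y)
    (h : ∀ᵐ t ∂(volume.restrict (Ioi (0 : ℝ))), f (y, t) = U t) :
    fiberTrace k a b f y = U (e y) :=
  (hT.tendsto (fun t => f (y, t)) U hU h y hy).limUnder_eq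

/-- A function with a weak derivative is a continuous primitive on almost every line. -/
lemma HasWeakDerivSnd.ae_primitive {f g : ℝ × ℝ → ℂ} (hfg : HasWeakDerivSnd f g)
    (hf : MemLp f 2 quadMeasure) (hg : MemLp g 2 quadMeasure)
    (hfm : StronglyMeasurable f) (hgm : StronglyMeasurable g) :
    ∀ᵐ y ∂(volume.restrict (Ioi (0 : ℝ))), 0 < y ∧
      MemLp (fun t => f (y, t)) 2 (volume.restrict (Ioi (0 : ℝ))) ∧
      MemLp (fun t => g (y, t)) 2 (volume.restrict (Ioi (0 : ℝ))) ∧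
      ∃ c : ℂ, ∀ᵐ t ∂(volume.restrict (Ioi (0 : ℝ))),
        f (y, t) = primitive c (fun s => g (y, s)) t := by
  filter_upwards [ae_restrict_mem measurableSet_Ioi, ae_memLp_fiber hf, ae_memLp_fiber hg,
    hfg.exists_primitive hf hg hfm hgm] with y h0 h1 h2 ⟨c, hc⟩
  refine ⟨h0, h1, h2, c, ?_⟩
  filter_upwards [hc, ae_restrict_mem measurableSet_Ioi] with t ht ht0
  rw [ht, primitive_eq c _ (le_of_lt ht0)]

lemma IsFiberAverage.aestronglyMeasurable (hT : IsFiberAverage k a b e) {f g : ℝ × ℝ → ℂ}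
    (hfg : HasWeakDerivSnd f g) (hf : MemLp f 2 quadMeasure) (hg : MemLp g 2 quadMeasure)
    (hfm : StronglyMeasurable f) (hgm : StronglyMeasurable g) :
    AEStronglyMeasurable (fiberTrace k a b f) (volume.restrict (Ioi (0 : ℝ))) := by
  have hlim : Tendsto (fun n : ℕ => 1 / ((n : ℝ) + 1)) atTop (𝓝[>] 0) := by
    refine tendsto_nhdsWithin_iff.2 ⟨tendsto_one_div_add_atTop_nhds_zero_nat, ?_⟩
    exact Eventually.of_forall fun n => by
      simp only [mem_Ioi]
      positivity
  refine aestronglyMeasurable_of_tendsto_ae atTop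
    (f := fun (n : ℕ) y => k (1 / (n + 1)) •
      ∫ t in Ioc (a (1 / (n + 1)) y) (b (1 / (n + 1)) y), f (y, t)) (fun n => ?_) ?_
  · have h1 := stronglyMeasurable_integral_vertical hfm
      (a := fun p => a (1 / (n + 1)) p.1) (b := fun p => b (1 / (n + 1)) p.1)
      ((hT.measurable_left _).comp measurable_fst) ((hT.measurable_right _).comp measurable_fst)
    have h2 := h1.comp_measurable (g := fun y : ℝ => (y, (0 : ℝ))) (by fun_prop)
    exact h2.aestronglyMeasurable.const_smul (k (1 / ((n : ℝ) + 1)))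
  · filter_upwards [hfg.ae_primitive hf hg hfm hgm] with y ⟨hy, h1, h2, c, hc⟩
    rw [hT.fiberTrace_eq (continuous_primitive h2 c) hy hc]
    exact (hT.tendsto _ _ (continuous_primitive h2 c) hc y hy).comp hlim

lemma integral_quadrant_eq {f : ℝ × ℝ → ℝ} (hf : Integrable f quadMeasure) :
    ∫ p in quadrant, f p = ∫ y in Ioi (0 : ℝ), ∫ t in Ioi (0 : ℝ), f (y, t) := by
  have hf' := hf
  rw [quadMeasure_eq_prod] at hf'
  rw [show (volume.restrict quadrant : Measure (ℝ × ℝ)) = quadMeasure from rfl,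
    quadMeasure_eq_prod, integral_prod _ hf']

/-- The trace inequality, obtained by integrating the one-dimensional Sobolev inequality. -/
lemma IsFiberAverage.memLp_and_integral_le (hT : IsFiberAverage k a b e) {f g : ℝ × ℝ → ℂ}
    (hfg : HasWeakDerivSnd f g) (hf : MemLp f 2 quadMeasure) (hg : MemLp g 2 quadMeasure)
    (hfm : StronglyMeasurable f) (hgm : StronglyMeasurable g) :
    MemLp (fiberTrace k a b f) 2 (volume.restrict (Ioi (0 : ℝ))) ∧
    ∀ ε : ℝ, 0 < ε → ∫ y in Ioi (0 : ℝ), ‖fiberTrace k a b f y‖ ^ 2 ≤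
      2 * (ε⁻¹ * (∫ p in quadrant, ‖f p‖ ^ 2) + ε * ∫ p in quadrant, ‖g p‖ ^ 2) := by
  have hf2 : Integrable (fun p => ‖f p‖ ^ 2) quadMeasure :=
    (memLp_two_iff_integrable_sq_norm hf.1).1 hf
  have hg2 : Integrable (fun p => ‖g p‖ ^ 2) quadMeasure :=
    (memLp_two_iff_integrable_sq_norm hg.1).1 hg
  have hbd : ∀ ε : ℝ, 0 < ε → ∀ᵐ y ∂(volume.restrict (Ioi (0 : ℝ))),
      ‖fiberTrace k a b f y‖ ^ 2 ≤ 2 * (ε⁻¹ * (∫ t in Ioi (0 : ℝ), ‖f (y, t)‖ ^ 2) +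
        ε * ∫ t in Ioi (0 : ℝ), ‖g (y, t)‖ ^ 2) := by
    intro ε hε
    filter_upwards [hfg.ae_primitive hf hg hfm hgm] with y ⟨hy, h1, h2, c, hc⟩
    rw [hT.fiberTrace_eq (continuous_primitive h2 c) hy hc]
    exact sq_norm_primitive_le h1 h2 hc (hT.nonneg y hy) hε
  have hI : ∀ ε : ℝ, Integrable (fun y => 2 * (ε⁻¹ * (∫ t in Ioi (0 : ℝ), ‖f (y, t)‖ ^ 2) +
        ε * ∫ t in Ioi (0 : ℝ), ‖g (y, t)‖ ^ 2)) (volume.restrict (Ioi (0 : ℝ))) := by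
    intro ε
    rw [quadMeasure_eq_prod] at hf2 hg2
    exact ((hf2.integral_prod_left.const_mul _).add (hg2.integral_prod_left.const_mul _)).const_mul _
  have hm := hT.aestronglyMeasurable hfg hf hg hfm hgm
  have hsq : Integrable (fun y => ‖fiberTrace k a b f y‖ ^ 2) (volume.restrict (Ioi (0 : ℝ))) := by
    refine (hI 1).mono' (hm.norm.pow 2) ?_
    filter_upwards [hbd 1 one_pos] with y hy
    rwa [Real.norm_of_nonneg (by positivity)]
  refine ⟨(memLp_two_iff_integrable_sq_norm hm).2 hsq, fun ε hε => ?_⟩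
  refine (integral_mono_ae hsq (hI ε) (hbd ε hε)).trans (le_of_eq ?_)
  rw [integral_quadrant_eq hf2, integral_quadrant_eq hg2, integral_const_mul, integral_add,
    integral_const_mul, integral_const_mul]
  · rw [quadMeasure_eq_prod] at hf2
    exact hf2.integral_prod_left.const_mul _
  · rw [quadMeasure_eq_prod] at hg2
    exact hg2.integral_prod_left.const_mul _

/-- Traces are linear almost everywhere: on almost every line both functions are continuous
primitives, and the trace evaluates their linear combination at a point. -/
lemma IsFiberAverage.fiberTrace_add_smul (hT : IsFiberAverage k a b e) {f₁ g₁ f₂ g₂ f₃ : ℝ × ℝ → ℂ}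
    (h₁ : HasWeakDerivSnd f₁ g₁) (hf₁ : MemLp f₁ 2 quadMeasure) (hg₁ : MemLp g₁ 2 quadMeasure)
    (hfm₁ : StronglyMeasurable f₁) (hgm₁ : StronglyMeasurable g₁)
    (h₂ : HasWeakDerivSnd f₂ g₂) (hf₂ : MemLp f₂ 2 quadMeasure) (hg₂ : MemLp g₂ 2 quadMeasure)
    (hfm₂ : StronglyMeasurable f₂) (hgm₂ : StronglyMeasurable g₂)
    (r : ℝ) (h₃ : ∀ᵐ p ∂quadMeasure, f₃ p = f₁ p + r • f₂ p) :
    ∀ᵐ y ∂(volume.restrict (Ioi (0 : ℝ))),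
      fiberTrace k a b f₃ y = fiberTrace k a b f₁ y + r • fiberTrace k a b f₂ y := by
  rw [quadMeasure_eq_prod] at h₃
  filter_upwards [h₁.ae_primitive hf₁ hg₁ hfm₁ hgm₁, h₂.ae_primitive hf₂ hg₂ hfm₂ hgm₂,
    Measure.ae_ae_of_ae_prod h₃] with y ⟨hy, _, m₁, c₁, hc₁⟩ ⟨_, _, m₂, c₂, hc₂⟩ hy₃
  have C₁ := continuous_primitive m₁ c₁
  have C₂ := continuous_primitive m₂ c₂
  rw [hT.fiberTrace_eq C₁ hy hc₁, hT.fiberTrace_eq C₂ hy hc₂,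
    hT.fiberTrace_eq (C₁.add (C₂.const_smul r)) hy]
  · rfl
  · filter_upwards [hc₁, hc₂, hy₃] with t t1 t2 t3
    rw [t3, t1, t2]
    rfl

end FiberTrace

/-! ### The Sobolev space and its traces -/

lemma isWeakDeriv_weakDeriv {v : ℝ × ℝ} {φ : L2Quadrant} (h : ∃ g, IsWeakDeriv v φ g) :
    IsWeakDeriv v φ (weakDeriv v φ) := by
  rw [weakDeriv, dif_pos h]
  exact h.choose_spec

lemma integrable_testFunction_smul {θ : ℝ × ℝ → ℝ} (hθ : Continuous θ) (hθs : HasCompactSupport θ)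
    {f : ℝ × ℝ → ℂ} (hf : MemLp f 2 quadMeasure) :
    Integrable (fun p => θ p • f p) quadMeasure := by
  have h1 : LocallyIntegrable f quadMeasure := hf.locallyIntegrable (by norm_num)
  exact h1.integrable_smul_left_of_hasCompactSupport hθ hθs

lemma IsTestFunction.continuous_fderiv_apply {η : ℝ × ℝ → ℝ} (hη : IsTestFunction η)
    (v : ℝ × ℝ) : Continuous fun p => fderiv ℝ η p v :=
  (hη.1.continuous_fderiv (by simp)).clm_apply continuous_const

lemma IsTestFunction.hasCompactSupport_fderiv_apply {η : ℝ × ℝ → ℝ} (hη : IsTestFunction η)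
    (v : ℝ × ℝ) : HasCompactSupport fun p => fderiv ℝ η p v :=
  hη.2.1.fderiv_apply (𝕜 := ℝ) v

/-- Weak derivatives are unique. -/
lemma IsWeakDeriv.ae_eq {v : ℝ × ℝ} {φ g₁ g₂ : L2Quadrant} (h₁ : IsWeakDeriv v φ g₁)
    (h₂ : IsWeakDeriv v φ g₂) : g₁ =ᵐ[quadMeasure] g₂ := by
  have hloc : LocallyIntegrable (fun p => g₁ p - g₂ p) quadMeasure :=
    ((Lp.memLp g₁).sub (Lp.memLp g₂)).locallyIntegrable (by norm_num)
  have h := isOpen_quadrant.ae_eq_zero_of_integral_contDiff_smul_eq_zero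
    (hloc.locallyIntegrableOn quadrant) (fun η a1 a2 a3 => by
      have hη : IsTestFunction η := ⟨a1, a2, a3⟩
      simp_rw [smul_sub]
      rw [integral_sub (integrable_testFunction_smul a1.continuous a2 (Lp.memLp g₁))
        (integrable_testFunction_smul a1.continuous a2 (Lp.memLp g₂)), sub_eq_zero,
        ← neg_inj, ← h₁ η hη, ← h₂ η hη])
  filter_upwards [h, ae_restrict_mem measurableSet_quadrant] with p hp hq
  exact sub_eq_zero.1 (hp hq)

lemma ae_add_smul (ψ χ : L2Quadrant) (t : ℝ) :
    ∀ᵐ p ∂quadMeasure, (ψ + t • χ : L2Quadrant) p = ψ p + t • χ p := by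
  filter_upwards [Lp.coeFn_add ψ (t • χ), Lp.coeFn_smul t χ] with p h1 h2
  rw [h1, Pi.add_apply, h2, Pi.smul_apply]

lemma IsWeakDeriv.add_smul {v : ℝ × ℝ} {ψ χ g₁ g₂ : L2Quadrant} (h₁ : IsWeakDeriv v ψ g₁)
    (h₂ : IsWeakDeriv v χ g₂) (t : ℝ) : IsWeakDeriv v (ψ + t • χ) (g₁ + t • g₂) := by
  intro η hη
  have key : ∀ (θ : ℝ × ℝ → ℝ), Continuous θ → HasCompactSupport θ → ∀ f₁ f₂ : L2Quadrant,
      ∫ p in quadrant, θ p • (f₁ + t • f₂ : L2Quadrant) p =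
        (∫ p in quadrant, θ p • f₁ p) + t • ∫ p in quadrant, θ p • f₂ p := by
    intro θ hθ hθs f₁ f₂
    rw [← integral_smul, ← integral_add (integrable_testFunction_smul hθ hθs (Lp.memLp f₁))
      (by exact (integrable_testFunction_smul hθ hθs (Lp.memLp f₂)).smul t)]
    refine integral_congr_ae ?_
    filter_upwards [ae_add_smul f₁ f₂ t] with p hp
    rw [hp, smul_add, smul_comm]
  rw [key _ (hη.continuous_fderiv_apply v) (hη.hasCompactSupport_fderiv_apply v),
    key _ hη.1.continuous hη.2.1, h₁ η hη, h₂ η hη, smul_neg, ← neg_add]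

lemma SobolevH1.add_smul {ψ χ : L2Quadrant} (hψ : ψ ∈ SobolevH1) (hχ : χ ∈ SobolevH1) (t : ℝ) :
    ψ + t • χ ∈ SobolevH1 := by
  obtain ⟨⟨a₁, ha₁⟩, b₁, hb₁⟩ := hψ
  obtain ⟨⟨a₂, ha₂⟩, b₂, hb₂⟩ := hχ
  exact ⟨⟨_, ha₁.add_smul ha₂ t⟩, _, hb₁.add_smul hb₂ t⟩

lemma weakDeriv_add_smul {v : ℝ × ℝ} {ψ χ : L2Quadrant} (hψ : ∃ g, IsWeakDeriv v ψ g)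
    (hχ : ∃ g, IsWeakDeriv v χ g) (t : ℝ) :
    ∀ᵐ p ∂quadMeasure, weakDeriv v (ψ + t • χ) p = weakDeriv v ψ p + t • weakDeriv v χ p := by
  have h1 := (isWeakDeriv_weakDeriv hψ).add_smul (isWeakDeriv_weakDeriv hχ) t
  have h2 := (isWeakDeriv_weakDeriv ⟨_, h1⟩).ae_eq h1
  filter_upwards [h2, ae_add_smul (weakDeriv v ψ) (weakDeriv v χ) t] with p hp hq
  rw [hp, hq]

lemma integral_norm_sq_eq (φ : L2Quadrant) : ∫ p in quadrant, ‖φ p‖ ^ 2 = ‖φ‖ ^ 2 := by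
  have h : (inner ℂ φ φ : ℂ) = ((∫ p in quadrant, ‖φ p‖ ^ 2 : ℝ) : ℂ) := by
    rw [L2.inner_def, ← integral_complex_ofReal]
    congr 1
    ext p
    rw [inner_self_eq_norm_sq_to_K]
    simp
  rw [inner_self_eq_norm_sq_to_K] at h
  have h2 : ((‖φ‖ ^ 2 : ℝ) : ℂ) = ((∫ p in quadrant, ‖φ p‖ ^ 2 : ℝ) : ℂ) := by
    rw [← h]
    simp
  exact_mod_cast h2.symm

/-- The properties of a trace operator that enter the analysis of the form. -/
structure IsTraceMap (T : L2Quadrant → ℝ → ℂ) : Prop where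
  memLp : ∀ φ ∈ SobolevH1, MemLp (T φ) 2 (volume.restrict (Ioi (0 : ℝ)))
  integral_le : ∀ φ ∈ SobolevH1, ∀ ε : ℝ, 0 < ε → ∫ y in Ioi (0 : ℝ), ‖T φ y‖ ^ 2 ≤
    2 * (ε⁻¹ * ‖φ‖ ^ 2 + ε * (‖weakDeriv (1, 0) φ‖ ^ 2 + ‖weakDeriv (0, 1) φ‖ ^ 2))
  add_smul : ∀ ψ ∈ SobolevH1, ∀ χ ∈ SobolevH1, ∀ t : ℝ,
    ∀ᵐ y ∂(volume.restrict (Ioi (0 : ℝ))), T (ψ + t • χ) y = T ψ y + t • T χ y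

lemma IsFiberAverage.isTraceMap {k : ℝ → ℝ} {a b : ℝ → ℝ → ℝ} {e : ℝ → ℝ}
    (hT : IsFiberAverage k a b e) : IsTraceMap fun φ => fiberTrace k a b φ where
  memLp φ hφ := (hT.memLp_and_integral_le (isWeakDeriv_weakDeriv hφ.2) (Lp.memLp φ)
    (Lp.memLp _) (Lp.stronglyMeasurable φ) (Lp.stronglyMeasurable _)).1
  integral_le φ hφ ε hε := by
    have h := (hT.memLp_and_integral_le (isWeakDeriv_weakDeriv hφ.2) (Lp.memLp φ)
      (Lp.memLp _) (Lp.stronglyMeasurable φ) (Lp.stronglyMeasurable _)).2 ε hε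
    rw [integral_norm_sq_eq, integral_norm_sq_eq] at h
    refine h.trans ?_
    gcongr
    linarith [sq_nonneg ‖weakDeriv (1, 0) φ‖]
  add_smul ψ hψ χ hχ t := hT.fiberTrace_add_smul
    (isWeakDeriv_weakDeriv hψ.2) (Lp.memLp ψ) (Lp.memLp _) (Lp.stronglyMeasurable ψ)
    (Lp.stronglyMeasurable _) (isWeakDeriv_weakDeriv hχ.2) (Lp.memLp χ) (Lp.memLp _)
    (Lp.stronglyMeasurable χ) (Lp.stronglyMeasurable _) t (ae_add_smul ψ χ t)

lemma measurePreserving_swap_quadrant : MeasurePreserving Prod.swap quadMeasure quadMeasure := by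
  rw [quadMeasure_eq_prod]
  exact Measure.measurePreserving_swap

lemma IsTestFunction.comp_swap {η : ℝ × ℝ → ℝ} (hη : IsTestFunction η) :
    IsTestFunction fun p => η p.swap := by
  obtain ⟨h1, h2, h3⟩ := hη
  refine ⟨h1.comp (contDiff_snd.prodMk contDiff_fst), ?_, ?_⟩
  · exact h2.comp_homeomorph (Homeomorph.prodComm ℝ ℝ)
  · have : tsupport (fun p : ℝ × ℝ => η p.swap) ⊆ Prod.swap ⁻¹' tsupport η :=
      closure_minimal (fun p hp => subset_closure hp)
        ((isClosed_tsupport η).preimage continuous_swap)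
    intro p hp
    have := h3 (this hp)
    exact ⟨this.2, this.1⟩

/-- Reflection in the diagonal exchanges the two partial derivatives. -/
lemma IsWeakDeriv.swap {φ g : L2Quadrant} (h : IsWeakDeriv (1, 0) φ g) :
    HasWeakDerivSnd (fun p => φ p.swap) fun p => g p.swap := by
  intro η hη
  have hs := measurePreserving_swap_quadrant
  have hemb : MeasurableEmbedding (Prod.swap : ℝ × ℝ → ℝ × ℝ) :=
    MeasurableEquiv.prodComm.measurableEmbedding
  have h1 := h _ hη.comp_swap
  have hfd (p : ℝ × ℝ) :
      fderiv ℝ (fun q : ℝ × ℝ => η q.swap) p (1, 0) = fderiv ℝ η p.swap (0, 1) := by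
    have a := (hη.1.differentiable (by simp) p.swap).hasFDerivAt.comp p
      (hasFDerivAt_snd.prodMk hasFDerivAt_fst : HasFDerivAt (fun q : ℝ × ℝ => (q.2, q.1)) _ p)
    have e : (fun q : ℝ × ℝ => η q.swap) = η ∘ Prod.swap := rfl
    rw [e, a.fderiv]
    simp
  simp_rw [hfd] at h1
  rw [← hs.integral_comp hemb, ← hs.integral_comp hemb fun p => η p • g p.swap]
  simpa using h1

lemma isTraceMap_bottom : IsTraceMap traceBottom := isFiberAverage_lower.isTraceMap

lemma isTraceMap_diag : IsTraceMap traceDiag := isFiberAverage_diagonal.isTraceMap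

/-- The trace on the left edge is the trace on the bottom edge of the reflected function. -/
lemma isTraceMap_left : IsTraceMap traceLeft := by
  have hs := measurePreserving_swap_quadrant
  have hemb : MeasurableEmbedding (Prod.swap : ℝ × ℝ → ℝ × ℝ) :=
    MeasurableEquiv.prodComm.measurableEmbedding
  have hL (φ : L2Quadrant) : MemLp (fun p : ℝ × ℝ => φ p.swap) 2 quadMeasure :=
    (Lp.memLp φ).comp_measurePreserving hs
  have hM (φ : L2Quadrant) : StronglyMeasurable (fun p : ℝ × ℝ => φ p.swap) :=
    (Lp.stronglyMeasurable φ).comp_measurable measurable_swap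
  have hI (φ : L2Quadrant) : ∫ p in quadrant, ‖φ p.swap‖ ^ 2 = ‖φ‖ ^ 2 := by
    rw [← integral_norm_sq_eq]
    exact hs.integral_comp hemb fun p => ‖φ p‖ ^ 2
  refine ⟨fun φ hφ => ?_, fun φ hφ ε hε => ?_, fun ψ hψ χ hχ t => ?_⟩
  · exact (isFiberAverage_lower.memLp_and_integral_le (isWeakDeriv_weakDeriv hφ.1).swap (hL _)
      (hL _) (hM _) (hM _)).1
  · have h := (isFiberAverage_lower.memLp_and_integral_le (isWeakDeriv_weakDeriv hφ.1).swap (hL _)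
      (hL _) (hM _) (hM _)).2 ε hε
    rw [hI, hI] at h
    refine h.trans ?_
    gcongr
    linarith [sq_nonneg ‖weakDeriv (0, 1) φ‖]
  · exact isFiberAverage_lower.fiberTrace_add_smul (isWeakDeriv_weakDeriv hψ.1).swap (hL _)
      (hL _) (hM _) (hM _) (isWeakDeriv_weakDeriv hχ.1).swap (hL _) (hL _) (hM _) (hM _) t
      (f₃ := fun p => (ψ + t • χ : L2Quadrant) p.swap)
      (hs.quasiMeasurePreserving.ae (ae_add_smul ψ χ t))

/-! ### The quadratic form -/

section WeightedEnergy

variable {X : Type*} [MeasurableSpace X] {μ : Measure X}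

/-- The real part of the weighted inner product `∫ w conj(A) B`. -/
noncomputable def weightedInner (μ : Measure X) (w : X → ℝ) (A B : X → ℂ) : ℝ :=
  ∫ x, w x * (conj (A x) * B x).re ∂μ

lemma exists_ae_abs_le {w : X → ℝ} (hw : MemLp w ∞ μ) : ∃ S : ℝ, 0 ≤ S ∧ ∀ᵐ x ∂μ, |w x| ≤ S := by
  refine ⟨(eLpNorm w (∞ : ℝ≥0∞) μ).toReal, ENNReal.toReal_nonneg, ?_⟩
  rw [eLpNorm_exponent_top]
  filter_upwards [ae_le_eLpNormEssSup (f := w) (μ := μ)] with x hx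
  have hfin : eLpNormEssSup w μ ≠ (∞ : ℝ≥0∞) := by
    rw [← eLpNorm_exponent_top]
    exact hw.2.ne
  have := ENNReal.toReal_mono hfin hx
  simpa using this

lemma integrable_weighted {w : X → ℝ} (hw : MemLp w ∞ μ) {A B : X → ℂ} (hA : MemLp A 2 μ)
    (hB : MemLp B 2 μ) : Integrable (fun x => (w x : ℂ) * (conj (A x) * B x)) μ := by
  obtain ⟨S, hS0, hS⟩ := exists_ae_abs_le hw
  have h1 : Integrable (fun x => conj (A x) * B x) μ := hA.star.integrable_mul hB
  refine h1.bdd_mul (c := S) ?_ ?_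
  · exact Complex.continuous_ofReal.comp_aestronglyMeasurable hw.1
  · filter_upwards [hS] with x hx
    simpa using hx

lemma integrable_weighted_re {w : X → ℝ} (hw : MemLp w ∞ μ) {A B : X → ℂ} (hA : MemLp A 2 μ)
    (hB : MemLp B 2 μ) : Integrable (fun x => w x * (conj (A x) * B x).re) μ := by
  refine (integrable_weighted hw hA hB).re.congr (ae_of_all _ fun x => ?_)
  simp only [RCLike.re_to_complex, Complex.re_ofReal_mul]

lemma re_integral_weighted {w : X → ℝ} (hw : MemLp w ∞ μ) {A B : X → ℂ} (hA : MemLp A 2 μ)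
    (hB : MemLp B 2 μ) :
    (∫ x, (w x : ℂ) * (conj (A x) * B x) ∂μ).re = weightedInner μ w A B := by
  have := integral_re (integrable_weighted hw hA hB)
  simp only [RCLike.re_to_complex] at this
  rw [← this, weightedInner]
  simp only [Complex.re_ofReal_mul]

lemma weightedInner_add_smul {w : X → ℝ} (hw : MemLp w ∞ μ) {A B C : X → ℂ} (hA : MemLp A 2 μ)
    (hB : MemLp B 2 μ) (t : ℝ) (hC : ∀ᵐ x ∂μ, C x = A x + t • B x) :
    weightedInner μ w C C =
      weightedInner μ w A A + 2 * t * weightedInner μ w A B + t ^ 2 * weightedInner μ w B B := by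
  have hAB : Integrable (fun x => w x * (conj (A x) * A x).re +
      2 * t * (w x * (conj (A x) * B x).re)) μ :=
    (integrable_weighted_re hw hA hA).add ((integrable_weighted_re hw hA hB).const_mul _)
  simp only [weightedInner]
  rw [← integral_const_mul, ← integral_const_mul,
    ← integral_add (integrable_weighted_re hw hA hA)
      ((integrable_weighted_re hw hA hB).const_mul _),
    ← integral_add hAB
      ((integrable_weighted_re hw hB hB).const_mul _)]
  refine integral_congr_ae ?_
  filter_upwards [hC] with x hx
  rw [hx]
  simp
  ring

lemma re_conj_mul_self (z : ℂ) : (conj z * z).re = ‖z‖ ^ 2 := by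
  rw [Complex.conj_mul', ← Complex.ofReal_pow, Complex.ofReal_re]

lemma abs_weightedInner_self_le {w : X → ℝ} {S : ℝ} (hS : ∀ᵐ x ∂μ, |w x| ≤ S) {A : X → ℂ}
    (hA : MemLp A 2 μ) :
    |weightedInner μ w A A| ≤ S * ∫ x, ‖A x‖ ^ 2 ∂μ := by
  have hA2 : Integrable (fun x => ‖A x‖ ^ 2) μ := (memLp_two_iff_integrable_sq_norm hA.1).1 hA
  rw [weightedInner, ← integral_const_mul, ← Real.norm_eq_abs]
  refine norm_integral_le_of_norm_le (hA2.const_mul S) ?_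
  filter_upwards [hS] with x hx
  rw [re_conj_mul_self, norm_mul, Real.norm_eq_abs, Real.norm_of_nonneg (sq_nonneg _)]
  gcongr

end WeightedEnergy

/-- Lebesgue measure on the half-line. -/
noncomputable abbrev halfLine : Measure ℝ := volume.restrict (Ioi (0 : ℝ))

lemma form_re {σ α : ℝ → ℝ} (hσ : MemLp σ ∞ halfLine) (hα : MemLp α ∞ halfLine)
    {ψ φ : L2Quadrant} (hψ : ψ ∈ SobolevH1) (hφ : φ ∈ SobolevH1) :
    (form σ α ψ φ).re =
      weightedInner quadMeasure (fun _ => 1) (weakDeriv (1, 0) ψ) (weakDeriv (1, 0) φ)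
      + weightedInner quadMeasure (fun _ => 1) (weakDeriv (0, 1) ψ) (weakDeriv (0, 1) φ)
      - weightedInner halfLine σ (traceBottom ψ) (traceBottom φ)
      - weightedInner halfLine σ (traceLeft ψ) (traceLeft φ)
      + weightedInner halfLine α (traceDiag ψ) (traceDiag φ) := by
  have h1 : MemLp (fun _ : ℝ × ℝ => (1 : ℝ)) ∞ quadMeasure := memLp_top_const 1
  have g (v : ℝ × ℝ) (φ : L2Quadrant) : MemLp (weakDeriv v φ) 2 quadMeasure := Lp.memLp _
  have bψ := isTraceMap_bottom.memLp ψ hψ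
  have bφ := isTraceMap_bottom.memLp φ hφ
  have lψ := isTraceMap_left.memLp ψ hψ
  have lφ := isTraceMap_left.memLp φ hφ
  have dψ := isTraceMap_diag.memLp ψ hψ
  have dφ := isTraceMap_diag.memLp φ hφ
  rw [← re_integral_weighted h1 (g _ ψ) (g _ φ), ← re_integral_weighted h1 (g _ ψ) (g _ φ),
    ← re_integral_weighted hσ bψ bφ, ← re_integral_weighted hσ lψ lφ,
    ← re_integral_weighted hα dψ dφ, form]
  have e1 := integral_add (integrable_weighted h1 (g (1, 0) ψ) (g (1, 0) φ))
    (integrable_weighted h1 (g (0, 1) ψ) (g (0, 1) φ))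
  have e2 := integral_add (integrable_weighted hσ bψ bφ) (integrable_weighted hσ lψ lφ)
  simp only [Complex.ofReal_one, one_mul, ← mul_add] at e1 e2 ⊢
  rw [e1, e2]
  simp only [Complex.add_re, Complex.sub_re]
  ring

lemma form_re_add_smul {σ α : ℝ → ℝ} (hσ : MemLp σ ∞ halfLine) (hα : MemLp α ∞ halfLine)
    {ψ χ : L2Quadrant} (hψ : ψ ∈ SobolevH1) (hχ : χ ∈ SobolevH1) (t : ℝ) :
    (form σ α (ψ + t • χ) (ψ + t • χ)).re =
      (form σ α ψ ψ).re + 2 * t * (form σ α ψ χ).re + t ^ 2 * (form σ α χ χ).re := by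
  have h1 : MemLp (fun _ : ℝ × ℝ => (1 : ℝ)) ∞ quadMeasure := memLp_top_const 1
  have hs := SobolevH1.add_smul hψ hχ t
  rw [form_re hσ hα hs hs, form_re hσ hα hψ hψ, form_re hσ hα hψ hχ, form_re hσ hα hχ hχ,
    weightedInner_add_smul h1 (Lp.memLp _) (Lp.memLp _) t (weakDeriv_add_smul hψ.1 hχ.1 t),
    weightedInner_add_smul h1 (Lp.memLp _) (Lp.memLp _) t (weakDeriv_add_smul hψ.2 hχ.2 t),
    weightedInner_add_smul hσ (isTraceMap_bottom.memLp _ hψ) (isTraceMap_bottom.memLp _ hχ) t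
      (isTraceMap_bottom.add_smul _ hψ _ hχ t),
    weightedInner_add_smul hσ (isTraceMap_left.memLp _ hψ) (isTraceMap_left.memLp _ hχ) t
      (isTraceMap_left.add_smul _ hψ _ hχ t),
    weightedInner_add_smul hα (isTraceMap_diag.memLp _ hψ) (isTraceMap_diag.memLp _ hχ) t
      (isTraceMap_diag.add_smul _ hψ _ hχ t)]
  ring

/-- The form is bounded below: with a small parameter in the trace inequality the boundary and
diagonal terms are absorbed into the gradient term. -/
lemma exists_form_lower_bound {σ α : ℝ → ℝ} (hσ : MemLp σ ∞ halfLine)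
    (hα : MemLp α ∞ halfLine) :
    ∃ C : ℝ, ∀ φ ∈ SobolevH1, -C * ‖φ‖ ^ 2 ≤ (form σ α φ φ).re := by
  obtain ⟨S, hS0, hS⟩ := exists_ae_abs_le hσ
  obtain ⟨A, hA0, hA⟩ := exists_ae_abs_le hα
  set K := 2 * S + A with hK
  have hK0 : 0 ≤ K := by positivity
  -- the trace terms contribute at most `2 K ε ‖∇φ‖²`, so `2 K ε ≤ 1` is needed
  set ε : ℝ := (2 * K + 1)⁻¹ with hε
  have hεpos : 0 < ε := by positivity
  refine ⟨K * (2 * ε⁻¹), fun φ hφ => ?_⟩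
  set D := ‖weakDeriv (1, 0) φ‖ ^ 2 + ‖weakDeriv (0, 1) φ‖ ^ 2 with hD
  have hD0 : 0 ≤ D := by positivity
  have grad (v : ℝ × ℝ) : weightedInner quadMeasure (fun _ => 1) (weakDeriv v φ) (weakDeriv v φ) =
      ‖weakDeriv v φ‖ ^ 2 := by
    simp only [weightedInner, one_mul, re_conj_mul_self, integral_norm_sq_eq]
  set b := 2 * (ε⁻¹ * ‖φ‖ ^ 2 + ε * D) with hb
  have h1 := (abs_weightedInner_self_le hS (isTraceMap_bottom.memLp φ hφ)).trans
    (mul_le_mul_of_nonneg_left (isTraceMap_bottom.integral_le φ hφ ε hεpos) hS0)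
  have h2 := (abs_weightedInner_self_le hS (isTraceMap_left.memLp φ hφ)).trans
    (mul_le_mul_of_nonneg_left (isTraceMap_left.integral_le φ hφ ε hεpos) hS0)
  have h3 := (abs_weightedInner_self_le hA (isTraceMap_diag.memLp φ hφ)).trans
    (mul_le_mul_of_nonneg_left (isTraceMap_diag.integral_le φ hφ ε hεpos) hA0)
  rw [← hD, ← hb] at h1 h2 h3
  rw [form_re hσ hα hφ hφ, grad, grad]
  have h4 : K * b = K * (2 * ε⁻¹) * ‖φ‖ ^ 2 + (2 * K * ε) * D := by
    rw [hb]
    ring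
  have h5 : 2 * K * ε ≤ 1 := by
    rw [hε, ← div_eq_mul_inv, div_le_one (by positivity)]
    linarith
  have h6 : 2 * K * ε * D ≤ D := mul_le_of_le_one_left hD0 h5
  have h7 : K * b = S * b + S * b + A * b := by
    rw [hK]
    ring
  linarith [le_abs_self (weightedInner halfLine σ (traceBottom φ) (traceBottom φ)),
    le_abs_self (weightedInner halfLine σ (traceLeft φ) (traceLeft φ)),
    neg_abs_le (weightedInner halfLine α (traceDiag φ) (traceDiag φ))]

/-! ### Functions of `x + y` -/

/-- Integration by parts: classical derivatives are weak derivatives. -/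
lemma isWeakDeriv_toLp {v : ℝ × ℝ} {F G : ℝ × ℝ → ℂ} (hF : ContDiff ℝ 1 F)
    (hG : ∀ p, fderiv ℝ F p v = G p) (hFL : MemLp F 2 quadMeasure)
    (hGL : MemLp G 2 quadMeasure) : IsWeakDeriv v (hFL.toLp F) (hGL.toLp G) := by
  intro η hη
  have hGc : Continuous G := by
    have := (hF.continuous_fderiv one_ne_zero).clm_apply (continuous_const (y := v))
    simpa only [hG] using this
  have e1 : ∫ p in quadrant, fderiv ℝ η p v • (hFL.toLp F : L2Quadrant) p =
      ∫ p, fderiv ℝ η p v • F p := by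
    rw [← setIntegral_eq_integral_of_forall_compl_eq_zero (s := quadrant)
      (f := fun p => fderiv ℝ η p v • F p)]
    · refine integral_congr_ae ?_
      filter_upwards [hFL.coeFn_toLp] with p hp
      rw [hp]
    · intro p hp
      have h1 : fderiv ℝ η p = 0 := by
        by_contra h
        exact hp (hη.2.2 (support_fderiv_subset ℝ h))
      simp [h1]
  have e2 : ∫ p in quadrant, η p • (hGL.toLp G : L2Quadrant) p = ∫ p, η p • G p := by
    rw [← setIntegral_eq_integral_of_forall_compl_eq_zero (s := quadrant)
      (f := fun p => η p • G p)]
    · refine integral_congr_ae ?_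
      filter_upwards [hGL.coeFn_toLp] with p hp
      rw [hp]
    · intro p hp
      rw [image_eq_zero_of_notMem_tsupport (fun h => hp (hη.2.2 h)), zero_smul]
  rw [e1, e2]
  have hd := hη.continuous_fderiv_apply v
  have hds := hη.hasCompactSupport_fderiv_apply v
  have h := integral_smul_fderiv_eq_neg_fderiv_smul_of_integrable (μ := volume) (v := v)
    (𝕜 := ℝ) (f := η) (g := F)
    ((hd.smul hF.continuous).integrable_of_hasCompactSupport hds.smul_right)
    (by simp only [hG]; exact
      (hη.1.continuous.smul hGc).integrable_of_hasCompactSupport hη.2.1.smul_right)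
    ((hη.1.continuous.smul hF.continuous).integrable_of_hasCompactSupport hη.2.1.smul_right)
    (fun p _ => hη.1.differentiable (by simp) p) (fun p _ => hF.differentiable (by simp) p)
  simp only [hG] at h
  rw [h, neg_neg]

/-- The value of the form on a function of `x + y`. -/
lemma exists_form_eq_of_diagonal {σ α : ℝ → ℝ} (hσ : MemLp σ ∞ halfLine) (hα : MemLp α ∞ halfLine)
    {f f' : ℝ → ℝ} (hf : ContDiff ℝ 1 f) (hf' : ∀ s, HasDerivAt f (f' s) s)
    (hL : MemLp (fun p : ℝ × ℝ => (f (p.1 + p.2) : ℂ)) 2 quadMeasure)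
    (hL' : MemLp (fun p : ℝ × ℝ => (f' (p.1 + p.2) : ℂ)) 2 quadMeasure) :
    ∃ φ ∈ SobolevH1, (form σ α φ φ).re = 2 * (∫ p in quadrant, f' (p.1 + p.2) ^ 2)
      - 2 * (∫ y in Ioi (0 : ℝ), σ y * f y ^ 2) + ∫ y in Ioi (0 : ℝ), α y * f (2 * y) ^ 2 := by
  set F : ℝ × ℝ → ℂ := fun p => (f (p.1 + p.2) : ℂ) with hF
  have hFd : ∀ (p v : ℝ × ℝ), fderiv ℝ F p v = ((v.1 + v.2) * f' (p.1 + p.2) : ℝ) := by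
    intro p v
    have h1 : HasFDerivAt (fun p : ℝ × ℝ => p.1 + p.2)
        (ContinuousLinearMap.fst ℝ ℝ ℝ + ContinuousLinearMap.snd ℝ ℝ ℝ) p :=
      hasFDerivAt_fst.add hasFDerivAt_snd
    have h2 := (Complex.ofRealCLM.hasFDerivAt (x := f (p.1 + p.2))).comp p
      ((hf' (p.1 + p.2)).comp_hasFDerivAt p h1)
    have e : F = Complex.ofRealCLM ∘ (f ∘ fun p : ℝ × ℝ => p.1 + p.2) := rfl
    rw [e, h2.fderiv]
    simp
    ring
  have hFc : ContDiff ℝ 1 F :=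
    Complex.ofRealCLM.contDiff.comp (hf.comp (contDiff_fst.add contDiff_snd))
  have hw1 := isWeakDeriv_toLp hFc (v := (1, 0)) (fun p => by simp [hFd]) hL hL'
  have hw2 := isWeakDeriv_toLp hFc (v := (0, 1)) (fun p => by simp [hFd]) hL hL'
  set φ : L2Quadrant := hL.toLp F with hφdef
  have hφ : φ ∈ SobolevH1 := ⟨⟨_, hw1⟩, _, hw2⟩
  have hφF : ∀ᵐ p ∂quadMeasure, φ p = f (p.1 + p.2) := hL.coeFn_toLp
  have hgrad : ∀ v, IsWeakDeriv v φ (hL'.toLp _) →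
      weightedInner quadMeasure (fun _ => 1) (weakDeriv v φ) (weakDeriv v φ) =
        ∫ p in quadrant, f' (p.1 + p.2) ^ 2 := by
    intro v hv
    refine integral_congr_ae ?_
    filter_upwards [(isWeakDeriv_weakDeriv ⟨_, hv⟩).ae_eq hv, hL'.coeFn_toLp] with p h1 h2
    rw [h1, h2, re_conj_mul_self, one_mul, Complex.norm_real, Real.norm_eq_abs, sq_abs]
  -- the traces of a continuous function are its values
  have htr : ∀ {k : ℝ → ℝ} {a b : ℝ → ℝ → ℝ} {e : ℝ → ℝ}, IsFiberAverage k a b e →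
      ∀ {u : ℝ × ℝ → ℂ}, (∀ᵐ p ∂quadMeasure, u p = f (p.1 + p.2)) → ∀ w : ℝ → ℝ,
      weightedInner halfLine w (fiberTrace k a b u) (fiberTrace k a b u) =
        ∫ y in Ioi (0 : ℝ), w y * f (y + e y) ^ 2 := by
    intro k a b e hT u hu w
    rw [quadMeasure_eq_prod] at hu
    refine integral_congr_ae ?_
    filter_upwards [Measure.ae_ae_of_ae_prod hu, ae_restrict_mem measurableSet_Ioi] with y h1 hy
    have hU : Continuous fun t : ℝ => (f (y + t) : ℂ) :=
      Complex.continuous_ofReal.comp (hf.continuous.comp (by fun_prop))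
    rw [hT.fiberTrace_eq hU hy h1, re_conj_mul_self, Complex.norm_real, Real.norm_eq_abs, sq_abs]
  have hφswap : ∀ᵐ p ∂quadMeasure, φ p.swap = f (p.1 + p.2) := by
    filter_upwards [measurePreserving_swap_quadrant.quasiMeasurePreserving.ae hφF] with p hp
    rw [hp, Prod.fst_swap, Prod.snd_swap, add_comm]
  have t1 := htr isFiberAverage_lower hφF σ
  have t2 := htr isFiberAverage_lower hφswap σ
  have t3 := htr isFiberAverage_diagonal hφF α
  simp only [add_zero, ← two_mul] at t1 t2 t3
  refine ⟨φ, hφ, ?_⟩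
  rw [form_re hσ hα hφ hφ, hgrad _ hw1, hgrad _ hw2]
  -- by definition, the three traces are instances of `fiberTrace`
  change _ - weightedInner halfLine σ (fiberTrace _ _ _ φ) (fiberTrace _ _ _ φ)
    - weightedInner halfLine σ (fiberTrace _ _ _ fun p => φ p.swap)
      (fiberTrace _ _ _ fun p => φ p.swap)
    + weightedInner halfLine α (fiberTrace _ _ _ φ) (fiberTrace _ _ _ φ) = _
  rw [t1, t2, t3]
  ring

/-! ### Trial functions of small energy -/

lemma integrable_exp_add {m : ℝ} (hm : 0 < m) :
    Integrable (fun p : ℝ × ℝ => Real.exp (-m * (p.1 + p.2))) quadMeasure := by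
  have h := (exp_neg_integrableOn_Ioi 0 hm).mul_prod (exp_neg_integrableOn_Ioi 0 hm)
  rw [quadMeasure_eq_prod]
  refine h.congr (ae_of_all _ fun p => ?_)
  simp only [mul_add, Real.exp_add]

lemma integral_exp_add {m : ℝ} (hm : 0 < m) :
    ∫ p in quadrant, Real.exp (-m * (p.1 + p.2)) = 1 / m ^ 2 := by
  change ∫ p, Real.exp (-m * (p.1 + p.2)) ∂quadMeasure = _
  simp only [mul_add, Real.exp_add]
  rw [quadMeasure_eq_prod, integral_prod_mul (fun x => Real.exp (-m * x))
    (fun x => Real.exp (-m * x)), integral_exp_mul_Ioi (neg_neg_of_pos hm)]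
  simp
  field_simp

lemma memLp_exp_add {m : ℝ} (hm : 0 < m) :
    MemLp (fun p : ℝ × ℝ => Real.exp (-m * (p.1 + p.2))) 2 quadMeasure := by
  rw [memLp_two_iff_integrable_sq (by fun_prop)]
  refine (integrable_exp_add (m := 2 * m) (by positivity)).congr (ae_of_all _ fun p => ?_)
  simp only
  rw [sq, ← Real.exp_add]
  ring_nf

lemma integral_sq_sum_exp (N : ℕ) (c m : ℕ → ℝ) (hm : ∀ k, 0 < m k) :
    ∫ p in quadrant, (∑ k ∈ Finset.range N, c k * Real.exp (-m k * (p.1 + p.2))) ^ 2 =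
      ∑ j ∈ Finset.range N, ∑ k ∈ Finset.range N, c j * c k / (m j + m k) ^ 2 := by
  have hmm : ∀ j k, 0 < m j + m k := fun j k => add_pos (hm j) (hm k)
  have e : ∀ p : ℝ × ℝ, (∑ k ∈ Finset.range N, c k * Real.exp (-m k * (p.1 + p.2))) ^ 2 =
      ∑ j ∈ Finset.range N, ∑ k ∈ Finset.range N,
        c j * c k * Real.exp (-(m j + m k) * (p.1 + p.2)) := by
    intro p
    rw [sq, Finset.sum_mul_sum]
    refine Finset.sum_congr rfl fun j _ => Finset.sum_congr rfl fun k _ => ?_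
    rw [neg_add, add_mul, Real.exp_add]
    ring
  have hi : ∀ j k, Integrable (fun p : ℝ × ℝ =>
      c j * c k * Real.exp (-(m j + m k) * (p.1 + p.2))) quadMeasure :=
    fun j k => (integrable_exp_add (hmm j k)).const_mul _
  simp_rw [e]
  rw [integral_finsetSum _ fun j _ => integrable_finsetSum _ fun k _ => hi j k]
  refine Finset.sum_congr rfl fun j _ => ?_
  rw [integral_finsetSum _ fun k _ => hi j k]
  refine Finset.sum_congr rfl fun k _ => ?_
  rw [integral_const_mul, integral_exp_add (hmm j k)]
  ring

/-- The functions `e^{-2^k s}` of `s = x + y` are almost orthogonal in the Dirichlet inner product,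
so that their Gram matrix has entries of total size linear in their number. -/
lemma sum_dyadic_gram_le (N : ℕ) :
    ∑ j ∈ Finset.range N, ∑ k ∈ Finset.range N,
      ((2 : ℝ) ^ j * 2 ^ k) / (2 ^ j + 2 ^ k) ^ 2 ≤ (3 * N : ℝ) := by
  induction N with
  | zero => simp
  | succ N ih =>
    have hrow : ∑ j ∈ Finset.range N, ((2 : ℝ) ^ j * 2 ^ N) / (2 ^ j + 2 ^ N) ^ 2 ≤ 1 := by
      have h1 : ∀ j ∈ Finset.range N,
          ((2 : ℝ) ^ j * 2 ^ N) / (2 ^ j + 2 ^ N) ^ 2 ≤ 2 ^ j / 2 ^ N := by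
        intro j _
        have a : (0 : ℝ) < 2 ^ j := by positivity
        have b : (0 : ℝ) < 2 ^ N := by positivity
        -- `a b / (a + b)² ≤ a / b`, since `b² ≤ (a + b)²`
        rw [div_le_div_iff₀ (by positivity) b]
        nlinarith [mul_pos a b, mul_pos (mul_pos a b) a, pow_pos a 3]
      refine (Finset.sum_le_sum h1).trans ?_
      rw [← Finset.sum_div, geom_sum_eq (by norm_num), div_le_one (by positivity)]
      norm_num
    have hcol : ∑ j ∈ Finset.range N, ((2 : ℝ) ^ N * 2 ^ j) / (2 ^ N + 2 ^ j) ^ 2 ≤ 1 := by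
      simpa only [mul_comm ((2 : ℝ) ^ N), add_comm ((2 : ℝ) ^ N)] using hrow
    have hdiag : ((2 : ℝ) ^ N * 2 ^ N) / (2 ^ N + 2 ^ N) ^ 2 ≤ 1 := by
      rw [div_le_one (by positivity)]
      nlinarith [pow_pos (two_pos : (0 : ℝ) < 2) N]
    rw [Finset.sum_range_succ, Finset.sum_range_succ]
    simp_rw [Finset.sum_range_succ (fun k => _ / _) N]
    rw [Finset.sum_add_distrib]
    push_cast
    linarith

/-- The average of the exponentials `e^{-r 2^k s}`, `k < N`. -/
noncomputable def expAverage (N : ℕ) (r s : ℝ) : ℝ :=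
  ∑ k ∈ Finset.range N, (N : ℝ)⁻¹ * Real.exp (-(r * 2 ^ k) * s)

/-- The derivative of `expAverage N r`. -/
noncomputable def expAverageDeriv (N : ℕ) (r s : ℝ) : ℝ :=
  ∑ k ∈ Finset.range N, ((N : ℝ)⁻¹ * -(r * 2 ^ k)) * Real.exp (-(r * 2 ^ k) * s)

lemma hasDerivAt_expAverage (N : ℕ) (r s : ℝ) :
    HasDerivAt (expAverage N r) (expAverageDeriv N r s) s := by
  refine HasDerivAt.fun_sum fun k _ => ?_
  have h := (((hasDerivAt_id s).const_mul (-(r * 2 ^ k))).exp).const_mul (N : ℝ)⁻¹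
  refine h.congr_deriv ?_
  simp only [id, mul_one]
  ring

lemma contDiff_expAverage (N : ℕ) (r : ℝ) : ContDiff ℝ 1 (expAverage N r) := by
  unfold expAverage
  fun_prop

/-- The Dirichlet energy of `expAverage N r (x + y)` is of order `N⁻¹`, whatever the scale `r`. -/
lemma integral_sq_expAverageDeriv_le (N : ℕ) {r : ℝ} (hr : 0 < r) :
    ∫ p in quadrant, expAverageDeriv N r (p.1 + p.2) ^ 2 ≤ 3 / N := by
  unfold expAverageDeriv
  rw [integral_sq_sum_exp N _ (fun k => r * 2 ^ k) fun k => by positivity]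
  have e : ∀ j k : ℕ, (N : ℝ)⁻¹ * -(r * 2 ^ j) * ((N : ℝ)⁻¹ * -(r * 2 ^ k)) /
      (r * 2 ^ j + r * 2 ^ k) ^ 2 =
      ((N : ℝ)⁻¹) ^ 2 * (((2 : ℝ) ^ j * 2 ^ k) / (2 ^ j + 2 ^ k) ^ 2) := by
    intro j k
    field_simp
  simp_rw [e, ← Finset.mul_sum]
  refine (mul_le_mul_of_nonneg_left (sum_dyadic_gram_le N) (by positivity)).trans (le_of_eq ?_)
  rcases Nat.eq_zero_or_pos N with rfl | hN
  · simp
  · field_simp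

lemma abs_expAverage_le (N : ℕ) {r s : ℝ} (hr : 0 ≤ r) (hs : 0 ≤ s) : |expAverage N r s| ≤ 1 := by
  unfold expAverage
  rw [← Finset.mul_sum, abs_of_nonneg (by positivity)]
  have h : ∑ k ∈ Finset.range N, Real.exp (-(r * 2 ^ k) * s) ≤ ∑ k ∈ Finset.range N, (1 : ℝ) := by
    refine Finset.sum_le_sum fun k _ => ?_
    rw [Real.exp_le_one_iff, neg_mul, neg_nonpos]
    positivity
  refine (mul_le_mul_of_nonneg_left h (by positivity)).trans ?_
  simpa using inv_mul_le_one (a := (N : ℝ))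

lemma tendsto_expAverage {N : ℕ} (hN : 0 < N) (s : ℝ) :
    Tendsto (fun r => expAverage N r s) (𝓝[>] 0) (𝓝 1) := by
  have hc : Continuous fun r => expAverage N r s := by
    unfold expAverage
    fun_prop
  have h := hc.tendsto 0
  have h0 : expAverage N 0 s = 1 := by
    have : (N : ℝ) ≠ 0 := by positivity
    simp [expAverage, this]
  rw [h0] at h
  exact h.mono_left nhdsWithin_le_nhds

/-- Dominated convergence for the boundary and diagonal terms. -/
lemma tendsto_integral_mul_expAverage {N : ℕ} (hN : 0 < N) {w : ℝ → ℝ}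
    (hw : Integrable w halfLine) {d : ℝ} (hd : 0 ≤ d) :
    Tendsto (fun r => ∫ y in Ioi (0 : ℝ), w y * expAverage N r (d * y) ^ 2) (𝓝[>] 0)
      (𝓝 (∫ y in Ioi (0 : ℝ), w y)) := by
  refine tendsto_integral_filter_of_dominated_convergence (fun y => |w y|) ?_ ?_ hw.abs ?_
  · refine Eventually.of_forall fun r => hw.1.mul ?_
    have : Continuous fun y => expAverage N r (d * y) ^ 2 :=
      ((contDiff_expAverage N r).continuous.comp (by fun_prop)).pow 2
    exact this.aestronglyMeasurable
  · filter_upwards [self_mem_nhdsWithin] with r hr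
    filter_upwards [ae_restrict_mem measurableSet_Ioi] with y hy
    have h := abs_expAverage_le N (le_of_lt hr) (mul_nonneg hd (le_of_lt hy))
    rw [norm_mul, Real.norm_eq_abs, Real.norm_eq_abs, abs_pow]
    exact mul_le_of_le_one_right (abs_nonneg _) (pow_le_one₀ (abs_nonneg _) h)
  · refine ae_of_all _ fun y => ?_
    simpa using ((tendsto_expAverage hN (d * y)).pow 2).const_mul (w y)

/-- The form takes a negative value if `∫ (2σ - α) > 0`: first make the Dirichlet energy small,
then rescale until the trial function is close to `1` on the bulk of `σ` and `α`. -/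
lemma exists_form_neg {σ α : ℝ → ℝ} (hσ : MemLp σ ∞ halfLine) (hα : MemLp α ∞ halfLine)
    (hσi : Integrable σ halfLine) (hαi : Integrable α halfLine)
    (hpos : 0 < ∫ y in Ioi (0 : ℝ), (2 * σ y - α y)) :
    ∃ φ ∈ SobolevH1, (form σ α φ φ).re < 0 := by
  set m := ∫ y in Ioi (0 : ℝ), (2 * σ y - α y) with hm
  -- the energy is at most `6 / N`, the factor `2` coming from the two partial derivatives
  obtain ⟨N, hN⟩ := exists_nat_gt (6 / m)
  have hN0 : (0 : ℝ) < N := lt_trans (by positivity) hN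
  have hNpos : 0 < N := by exact_mod_cast hN0
  have hlim := ((tendsto_integral_mul_expAverage hNpos hαi zero_le_two).sub
    ((tendsto_integral_mul_expAverage hNpos hσi zero_le_one).const_mul 2))
  have hval : (∫ y in Ioi (0 : ℝ), α y) - 2 * ∫ y in Ioi (0 : ℝ), σ y = -m := by
    rw [hm, integral_sub (hσi.const_mul 2) hαi, integral_const_mul]
    ring
  have h6 : 6 / (N : ℝ) < m := by
    rw [div_lt_iff₀ hN0]
    rwa [div_lt_iff₀' hpos] at hN
  rw [hval] at hlim
  obtain ⟨r, hr, hr0⟩ := ((hlim.eventually_lt_const (show -m < -(6 / (N : ℝ)) by linarith)).and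
    self_mem_nhdsWithin).exists
  have hL : ∀ c : ℕ → ℝ, MemLp (fun p : ℝ × ℝ =>
      ((∑ k ∈ Finset.range N, c k * Real.exp (-(r * 2 ^ k) * (p.1 + p.2)) : ℝ) : ℂ)) 2
      quadMeasure := fun c => by
    have h := memLp_finsetSum (Finset.range N) fun k _ =>
      (memLp_exp_add (mul_pos hr0 (show (0 : ℝ) < 2 ^ k by positivity))).const_mul (c k)
    exact h.ofReal
  obtain ⟨φ, hφ, hval⟩ := exists_form_eq_of_diagonal hσ hα (contDiff_expAverage N r)
    (hasDerivAt_expAverage N r) (hL _) (hL _)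
  refine ⟨φ, hφ, ?_⟩
  have hE := integral_sq_expAverageDeriv_le N hr0
  have h3 : 2 * (3 / (N : ℝ)) = 6 / N := by ring
  simp only [one_mul] at hr
  rw [hval]
  linarith

end TwoParticle

theorem mainTheorem11 (σ α : ℝ → ℝ)
    (hσ_bdd : MemLp σ ∞ (volume.restrict (Ioi (0 : ℝ))))
    (hα_bdd : MemLp α ∞ (volume.restrict (Ioi (0 : ℝ))))
    (hσ_int : IntegrableOn σ (Ioi (0 : ℝ)))
    (hα_int : IntegrableOn α (Ioi (0 : ℝ)))
    (hess : IsGLB {E : ℝ | (E : ℂ) ∈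
      TwoParticle.essentialSpectrum (TwoParticle.hamiltonian σ α)} 0)
    (hpos : 0 < ∫ y in Ioi (0 : ℝ), (2 * σ y - α y)) :
    ∃ E : ℝ, E < 0 ∧
      TwoParticle.IsEigenvalue (TwoParticle.hamiltonian σ α) (E : ℂ) ∧
      (E : ℂ) ∈ TwoParticle.discreteSpectrum (TwoParticle.hamiltonian σ α) := by
  obtain ⟨φ, hφ, hneg⟩ := TwoParticle.exists_form_neg hσ_bdd hα_bdd hσ_int hα_int hpos
  obtain ⟨C, hC⟩ := TwoParticle.exists_form_lower_bound hσ_bdd hα_bdd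
  obtain ⟨E, hE, hspec⟩ := TwoParticle.exists_neg_mem_opSpectrum_of_form TwoParticle.SobolevH1
    (TwoParticle.form σ α) (fun ψ hψ χ hχ t => TwoParticle.SobolevH1.add_smul hψ hχ t)
    (fun ψ hψ χ hχ t => TwoParticle.form_re_add_smul hσ_bdd hα_bdd hψ hχ t) C hC φ hφ hneg
  have hdisc : (E : ℂ) ∈ TwoParticle.discreteSpectrum (TwoParticle.hamiltonian σ α) := by
    by_contra h
    exact absurd (hess.1 ⟨hspec, h⟩) (not_le.2 hE)
  exact ⟨E, hE, hdisc.1, hdisc⟩
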